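/- Let $K\ge 3$ and $m\ge 2$, and let $y=(y_{ij})$, $1\le i\le K$, $1\le j\le m$, be real (balanced) data. Consider the Bayesian random effects model in which, conditionally on $(\theta,\lambda_e)$, the $Y_{ij}\sim N(\theta_i,\lambda_e^{-1})$ are independent; conditionally on $(\mu,\lambda_\theta)$, the $\theta_i\sim N(\mu,\lambda_\theta^{-1})$ are independent; and, independently, $\lambda_e\sim\mathrm{Gamma}(a_2,b_2)$, $\mu\sim N(m_0,s_0^{-1})$, $\lambda_\theta\sim\mathrm{Gamma}(a_1,b_1)$ (shape, rate), where $a_1,b_1,a_2,b_2,s_0>0$ and $m_0\in\mathbb R$. Write $\lambda=(\lambda_\theta,\lambda_e)$, $\xi=(\theta,\mu)$, and let $\pi_h$ be the posterior distribution of $(\lambda,\xi)$ given $y$. The block Gibbs sampler is the Markov chain with transition density $k(\lambda,\xi\mid\lambda',\xi')=f(\lambda\mid\xi',y)\,f(\xi\mid\lambda,y)$, where the factors are the conditional densities of $\pi_h$; $P^n$ is its $n$-step kernel and $\|\mu-\nu\|=\sup_A|\mu(A)-\nu(A)|$. Put $\bar y_i=m^{-1}\sum_j y_{ij}$, $\bar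 y=K^{-1}\sum_i\bar y_i$, $\mathrm{SSE}=\sum_{i,j}(y_{ij}-\bar y_i)^2$, $M=mK$, $\delta_1=(2a_1+K-2)^{-1}$, $\delta_2=(2a_2+M-2)^{-1}$, $\delta_3=(K+1)\delta_2$, $\delta_5=K\delta_2$, $\delta=\max\{\delta_1,\delta_3\}$, $c_1=2b_1\delta_1$, $c_2=(2b_2+\mathrm{SSE})\delta_2$. Choose $\gamma\in(\delta,1)$, $\phi>0$ with $\phi\delta_5+\delta<\gamma$, set $$b=\phi c_1+\frac{\phi K+K+1}{m}c_2+\max\{\phi,1\}\sum_{i=1}^K\max\{(\bar y-\bar y_i)^2,(m_0-\bar y_i)^2\},$$ choose $d_R>2b/(1-\gamma)$, and set $\alpha=\frac{1+d_R}{1+2b+\gamma d_R}$, $U=1+2(\gamma d_R+b)$. Let $\varepsilon_B=\int_0^\infty h_1(x)\,dx\int_0^\infty h_2(x)\,dx$, where, with $\mathrm{Gamma}(\cdot,\cdot;x)$ the Gamma density at $x$, $h_1(x)=\mathrm{Gamma}(\frac K2+a_1,b_1;x)$ for $x<\lambda_\theta^*$ and $\mathrm{Gamma}(\frac K2+a_1,\frac{d_R}{2\phi}+b_1;x)$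 for $x\ge\lambda_\theta^*$, $\lambda_\theta^*=\frac{\phi(K+2a_1)}{d_R}\log\bigl(1+\frac{d_R}{2b_1\phi}\bigr)$; and $h_2(x)=\mathrm{Gamma}(\frac M2+a_2,\frac{\mathrm{SSE}}2+b_2;x)$ for $x<\lambda_e^*$ and $\mathrm{Gamma}(\frac M2+a_2,\frac{\mathrm{SSE}+md_R}2+b_2;x)$ for $x\ge\lambda_e^*$, $\lambda_e^*=\frac{M+2a_2}{md_R}\log\bigl(1+\frac{md_R}{2b_2+\mathrm{SSE}}\bigr)$. Let $\xi_0^{\rm opt}=(\theta,\mu)$ with $\theta_i=\frac{\phi\bar y+\bar y_i}{1+\phi}$, $\mu=\bar y$. For $0<r<1$ and $n\ge 0$ put $$B_r(n)=(1-\varepsilon_B)^{rn}+\Bigl(\frac{U^r}{\alpha^{1-r}}\Bigr)^n\Bigl(1+\frac b{1-\gamma}+\frac\phi{1+\phi}\sum_{i=1}^K(\bar y_i-\bar y)^2\Bigr).$$ Then admissible $(\gamma,\phi,d_R)$ exist, and for every admissible choice: (a) $\xi_0^{\rm opt}$ is the unique minimiser of $\phi\sum_i(\theta_i-\mu)^2+\sum_i(\theta_i-\bar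 y_i)^2$; (b) $0<\varepsilon_B<1$, and there is $r\in(0,1)$ with $B_r(n)\to0$ as $n\to\infty$; (c) for every $s_0>0$, $\pi_h$ is a probability measure, $P$ is a Markov kernel, and for every starting value $\lambda_0$, every $0<r<1$ and every $n\ge1$, $$\|P^n((\lambda_0,\xi_0^{\rm opt}),\cdot)-\pi_h\|\le B_r(n),$$ and moreover $\|P^N((\lambda_0,\xi_0^{\rm opt}),\cdot)-\pi_h\|\le B_r(n)$ for all $N\ge n$, that is, $n$ is a sufficient burn-in for the tolerance $B_r(n)$. Neither $B_r(n)$ nor the choice of $(\gamma,\phi,d_R)$, $r$ or $\xi_0^{\rm opt}$ involves $s_0$. -/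

import Mathlib

open MeasureTheory ProbabilityTheory
open scoped ENNReal

namespace RandomEffects

noncomputable section

/-- Hyperparameters of the hierarchical model other than the prior precision `s₀` of `μ`:
`λ_θ ∼ Gamma(a₁, b₁)`, `λ_e ∼ Gamma(a₂, b₂)` (shape, rate), and `μ` has prior mean `m₀`. -/
structure Prior where
  a₁ : ℝ
  b₁ : ℝ
  a₂ : ℝ
  b₂ : ℝ
  m₀ : ℝ

/-- The Gamma priors on `λ_θ` and `λ_e` are proper. -/
def Prior.Proper (h : Prior) : Prop := 0 < h.a₁ ∧ 0 < h.b₁ ∧ 0 < h.a₂ ∧ 0 < h.b₂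

/-- The user-chosen constants `γ`, `φ` and `d_R`. -/
structure Tuning where
  γ : ℝ
  φ : ℝ
  dR : ℝ

/-! ### Model, posterior and block Gibbs sampler -/

/-- `λ = (λ_θ, λ_e)`. -/
abbrev Prec := ℝ × ℝ

/-- `ξ = (θ, μ)`. -/
abbrev Loc (K : ℕ) := (Fin K → ℝ) × ℝ

/-- States `(λ, ξ) = ((λ_θ, λ_e), (θ, μ))`. All densities below vanish unless `λ_θ, λ_e > 0`
(up to a null set), so every measure below lives on `ℝ₊² × ℝ^K × ℝ`. -/
abbrev State (K : ℕ) := Prec × Loc K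

variable {K m : ℕ}

/-- The product `f(y | θ, λ_e) f(θ | μ, λ_θ) f(λ_e) f(μ) f(λ_θ)` for balanced data `y i j`. -/
def jointDensityReal (y : Fin K → Fin m → ℝ) (h : Prior) (s₀ : ℝ) (l : Prec) (ξ : Loc K) : ℝ :=
  (∏ i, ∏ j, gaussianPDFReal (ξ.1 i) (Real.toNNReal (l.2)⁻¹) (y i j)) *
  (∏ i, gaussianPDFReal ξ.2 (Real.toNNReal (l.1)⁻¹) (ξ.1 i)) *
  gammaPDFReal h.a₂ h.b₂ l.2 *
  gaussianPDFReal h.m₀ (Real.toNNReal s₀⁻¹) ξ.2 *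
  gammaPDFReal h.a₁ h.b₁ l.1

def jointDensity (y : Fin K → Fin m → ℝ) (h : Prior) (s₀ : ℝ) (l : Prec) (ξ : Loc K) : ℝ≥0∞ :=
  ENNReal.ofReal (jointDensityReal y h s₀ l ξ)

/-- The normalised posterior density `π_h(λ, ξ | y)` with respect to Lebesgue measure. -/
def posteriorDensity (y : Fin K → Fin m → ℝ) (h : Prior) (s₀ : ℝ) (x : State K) : ℝ≥0∞ :=
  jointDensity y h s₀ x.1 x.2 / ∫⁻ z : State K, jointDensity y h s₀ z.1 z.2

/-- The posterior distribution `π_h`. -/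
def posterior (y : Fin K → Fin m → ℝ) (h : Prior) (s₀ : ℝ) : Measure (State K) :=
  volume.withDensity (posteriorDensity y h s₀)

/-- The conditional posterior density `f(λ | ξ, y)`. -/
def condPrec (y : Fin K → Fin m → ℝ) (h : Prior) (s₀ : ℝ) (l : Prec) (ξ : Loc K) : ℝ≥0∞ :=
  jointDensity y h s₀ l ξ / ∫⁻ l' : Prec, jointDensity y h s₀ l' ξ

/-- The conditional posterior density `f(ξ | λ, y)`. -/
def condLoc (y : Fin K → Fin m → ℝ) (h : Prior) (s₀ : ℝ) (ξ : Loc K) (l : Prec) : ℝ≥0∞ :=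
  jointDensity y h s₀ l ξ / ∫⁻ ξ' : Loc K, jointDensity y h s₀ l ξ'

/-- The Markov transition density of the block Gibbs sampler from `x'` to `x`:
`k(λ, ξ | λ', ξ') = f(λ | ξ', y) f(ξ | λ, y)`. -/
def blockGibbsMTD (y : Fin K → Fin m → ℝ) (h : Prior) (s₀ : ℝ) (x' x : State K) : ℝ≥0∞ :=
  condPrec y h s₀ x.1 x'.2 * condLoc y h s₀ x.2 x.1

lemma measurable_jointDensity (y : Fin K → Fin m → ℝ) (h : Prior) (s₀ : ℝ) :
    Measurable (fun x : State K => jointDensity y h s₀ x.1 x.2) := by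
  have hG : Measurable (fun p : ℝ × ℝ × ℝ =>
      gaussianPDFReal p.1 (Real.toNNReal (p.2.1)⁻¹) p.2.2) := by
    unfold gaussianPDFReal
    fun_prop
  refine ENNReal.measurable_ofReal.comp ?_
  unfold jointDensityReal
  refine Measurable.mul (Measurable.mul (Measurable.mul (Measurable.mul ?_ ?_) ?_) ?_) ?_
  · refine Finset.measurable_prod _ fun i _ => Finset.measurable_prod _ fun j _ => ?_
    exact hG.comp (g := fun p : ℝ × ℝ × ℝ =>
      gaussianPDFReal p.1 (Real.toNNReal (p.2.1)⁻¹) p.2.2)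
      (f := fun x : State K => (x.2.1 i, x.1.2, y i j)) (by fun_prop)
  · refine Finset.measurable_prod _ fun i _ => ?_
    exact hG.comp (g := fun p : ℝ × ℝ × ℝ =>
      gaussianPDFReal p.1 (Real.toNNReal (p.2.1)⁻¹) p.2.2)
      (f := fun x : State K => (x.2.2, x.1.1, x.2.1 i)) (by fun_prop)
  · exact (measurable_gammaPDFReal _ _).comp (by fun_prop)
  · exact (measurable_gaussianPDFReal _ _).comp (by fun_prop)
  · exact (measurable_gammaPDFReal _ _).comp (by fun_prop)

lemma measurable_blockGibbsMTD (y : Fin K → Fin m → ℝ) (h : Prior) (s₀ : ℝ) :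
    Measurable (Function.uncurry (blockGibbsMTD y h s₀)) := by
  have hJ := measurable_jointDensity y h s₀
  have h1 : Measurable (fun ξ : Loc K => ∫⁻ l' : Prec, jointDensity y h s₀ l' ξ) :=
    Measurable.lintegral_prod_left' (f := fun x : State K => jointDensity y h s₀ x.1 x.2) hJ
  have h2 : Measurable (fun l : Prec => ∫⁻ ξ' : Loc K, jointDensity y h s₀ l ξ') :=
    Measurable.lintegral_prod_right' (f := fun x : State K => jointDensity y h s₀ x.1 x.2) hJ
  refine Measurable.mul (Measurable.div ?_ ?_) (Measurable.div ?_ ?_)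
  · exact hJ.comp (f := fun p : State K × State K => ((p.2.1, p.1.2) : State K)) (by fun_prop)
  · exact h1.comp (f := fun p : State K × State K => p.1.2) (by fun_prop)
  · exact hJ.comp (f := fun p : State K × State K => p.2) (by fun_prop)
  · exact h2.comp (f := fun p : State K × State K => p.2.1) (by fun_prop)

/-- The one-step transition kernel `P` of the block Gibbs sampler,
`P(x', A) = ∫_A k(x | x') dx`; its `n`-step kernel is the power `P ^ n`. -/
def blockGibbs (y : Fin K → Fin m → ℝ) (h : Prior) (s₀ : ℝ) : Kernel (State K) (State K) where
  toFun x' := volume.withDensity (blockGibbsMTD y h s₀ x')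
  measurable' := by
    refine Measure.measurable_of_measurable_coe _ fun A hA => ?_
    simp_rw [withDensity_apply _ hA]
    exact (measurable_blockGibbsMTD y h s₀).lintegral_prod_right'

/-- Total variation distance `sup_A |μ(A) - ν(A)|` over measurable sets `A`. -/
def tvDist {S : Type*} [MeasurableSpace S] (μ ν : Measure S) : ℝ :=
  ⨆ A : {A : Set S // MeasurableSet A}, |μ.real A.1 - ν.real A.1|

/-! ### The constants of the bound (none of them involves `s₀`) -/

/-- `ȳ_i`. -/
def cellMean (y : Fin K → Fin m → ℝ) (i : Fin K) : ℝ := (∑ j, y i j) / m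

/-- `ȳ`. -/
def grandMean (y : Fin K → Fin m → ℝ) : ℝ := (∑ i, cellMean y i) / K

def SSE (y : Fin K → Fin m → ℝ) : ℝ := ∑ i, ∑ j, (y i j - cellMean y i) ^ 2

/-- `v₁(θ, μ) = ∑ (θ_i - μ)²`. -/
def v₁ (ξ : Loc K) : ℝ := ∑ i, (ξ.1 i - ξ.2) ^ 2

/-- `v₂(θ) = ∑ m (θ_i - ȳ_i)²`. -/
def v₂ (y : Fin K → Fin m → ℝ) (θ : Fin K → ℝ) : ℝ := ∑ i, (m : ℝ) * (θ i - cellMean y i) ^ 2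

/-- The drift function `V₂(θ, μ) = φ v₁(θ, μ) + m⁻¹ v₂(θ)`. -/
def drift (y : Fin K → Fin m → ℝ) (φ : ℝ) (ξ : Loc K) : ℝ :=
  φ * v₁ ξ + (m : ℝ)⁻¹ * v₂ y ξ.1

/-- The starting value `ξ₀^opt`: `θ_i = (φ ȳ + ȳ_i) / (1 + φ)`, `μ = ȳ`. -/
def xiOpt (y : Fin K → Fin m → ℝ) (φ : ℝ) : Loc K :=
  (fun i => (φ * grandMean y + cellMean y i) / (1 + φ), grandMean y)

/-- `M = m K`. -/
def total (K m : ℕ) : ℝ := (m : ℝ) * K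

def δ₁ (K : ℕ) (h : Prior) : ℝ := 1 / (2 * h.a₁ + K - 2)
def δ₂ (K m : ℕ) (h : Prior) : ℝ := 1 / (2 * h.a₂ + total K m - 2)
def δ₃ (K m : ℕ) (h : Prior) : ℝ := (K + 1) * δ₂ K m h
def δ₅ (K m : ℕ) (h : Prior) : ℝ := K * δ₂ K m h
def δ (K m : ℕ) (h : Prior) : ℝ := max (δ₁ K h) (δ₃ K m h)
def c₁ (K : ℕ) (h : Prior) : ℝ := 2 * h.b₁ * δ₁ K h
def c₂ (y : Fin K → Fin m → ℝ) (h : Prior) : ℝ := (2 * h.b₂ + SSE y) * δ₂ K m h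

/-- The drift constant `b`. -/
def driftConst (y : Fin K → Fin m → ℝ) (h : Prior) (φ : ℝ) : ℝ :=
  φ * c₁ K h + ((φ * K + K + 1) / m) * c₂ y h +
    max φ 1 * ∑ i, max ((grandMean y - cellMean y i) ^ 2) ((h.m₀ - cellMean y i) ^ 2)

/-- The requirements on `γ`, `φ`, `d_R`. -/
def Tuning.Admissible (y : Fin K → Fin m → ℝ) (h : Prior) (c : Tuning) : Prop :=
  δ K m h < c.γ ∧ c.γ < 1 ∧ 0 < c.φ ∧ c.φ * δ₅ K m h + δ K m h < c.γ ∧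
    2 * driftConst y h c.φ / (1 - c.γ) < c.dR

/-- `λ_θ^*`. -/
def lamThetaStar (K : ℕ) (h : Prior) (c : Tuning) : ℝ :=
  c.φ * (K + 2 * h.a₁) / c.dR * Real.log (1 + c.dR / (2 * h.b₁ * c.φ))

/-- `λ_e^*`. -/
def lamErrStar (y : Fin K → Fin m → ℝ) (h : Prior) (c : Tuning) : ℝ :=
  (total K m + 2 * h.a₂) / (m * c.dR) * Real.log (1 + m * c.dR / (2 * h.b₂ + SSE y))

def h₁ (K : ℕ) (h : Prior) (c : Tuning) (x : ℝ) : ℝ :=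
  if x < lamThetaStar K h c then gammaPDFReal (K / 2 + h.a₁) h.b₁ x
  else gammaPDFReal (K / 2 + h.a₁) (c.dR / (2 * c.φ) + h.b₁) x

def h₂ (y : Fin K → Fin m → ℝ) (h : Prior) (c : Tuning) (x : ℝ) : ℝ :=
  if x < lamErrStar y h c then gammaPDFReal (total K m / 2 + h.a₂) (SSE y / 2 + h.b₂) x
  else gammaPDFReal (total K m / 2 + h.a₂) ((SSE y + m * c.dR) / 2 + h.b₂) x

/-- `ε_B`. -/
def epsB (y : Fin K → Fin m → ℝ) (h : Prior) (c : Tuning) : ℝ :=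
  (∫ x in Set.Ioi (0 : ℝ), h₁ K h c x) * ∫ x in Set.Ioi (0 : ℝ), h₂ y h c x

/-- `α = (1 + d_R) / (1 + 2b + γ d_R)`. -/
def alpha (y : Fin K → Fin m → ℝ) (h : Prior) (c : Tuning) : ℝ :=
  (1 + c.dR) / (1 + 2 * driftConst y h c.φ + c.γ * c.dR)

/-- `U = 1 + 2 (γ d_R + b)`. -/
def bigU (y : Fin K → Fin m → ℝ) (h : Prior) (c : Tuning) : ℝ :=
  1 + 2 * (c.γ * c.dR + driftConst y h c.φ)

/-- The explicit upper bound for the starting value `ξ₀^opt`, as a function of `r` and `n`. -/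
def burnInBound (y : Fin K → Fin m → ℝ) (h : Prior) (c : Tuning) (r : ℝ) (n : ℕ) : ℝ :=
  (1 - epsB y h c) ^ (r * n) +
    (bigU y h c ^ r / alpha y h c ^ (1 - r)) ^ n *
      (1 + driftConst y h c.φ / (1 - c.γ) +
        c.φ / (1 + c.φ) * ∑ i, (cellMean y i - grandMean y) ^ 2)

end

end RandomEffects

/-!
The bound on the block Gibbs sampler comes from a drift condition and a minorization condition whose
constants do not involve `s₀`, fed into Rosenthal's quantitative convergence theorem.

*Convergence theorem.* Let `P V ≤ γ V + b`, let `κ ≤ P x` whenever `V x ≤ d`, and let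
`d > 2 b / (1 - γ)`. For `u` with values in `[0, 1]`, the differences `Pⁿ u (x) - Pⁿ u (y)` are
bounded by induction on `n` (`DriftMinorization.iterate_average_sub_le`). If both points lie in
`{V ≤ d}`, the common part `κ` cancels from the two integrals, which gains a factor `1 - κ(S)`;
otherwise `1 + V x + V y` contracts on average by the factor `α > 1`. No coupling is constructed: a
function whose oscillation is bounded by `w s + w t` stays within `w` of a constant, and
`integral_sub_integral_le_of_common_part` follows by integrating against the residual measures.
Integrating over a stationary law, whose mean of `V` is at most `b / (1 - γ)`, and allowing about
`r n` visits gives `abs_iterate_average_sub_integral_le`. Invariance extends the bound of time `n`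
to all later times (`tvDist_pow_le`).

*The sampler.* Given `ξ`, the coordinates of `λ` are independent Gamma variables
(`exists_jointDensityReal_eq_precDensity`); given `λ`, `μ` is Gaussian with precision `s₀ + t`,
where `t` is `flatPrec`, and the `θ_i` are independent Gaussians given `μ`
(`exists_jointDensityReal_eq_locDensity`).

*Drift.* The mean of the drift function given `λ` is explicit. It depends on `s₀` through the
conditional variance of `μ`, which is at most `1 / t`, and through the conditional mean of `μ`,
which lies between `m₀` and `ȳ`; these two bounds are free of `s₀` (`sum_mean_drift_le`). The means
of `1 / λ_θ` and `1 / λ_e` given `ξ` are affine in `v₁` and `v₂`, which yields `drift_blockGibbs`.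

*Minorization.* On `{V₂ ≤ d_R}` the rates of the two Gamma laws range over bounded intervals. The
logarithm of a Gamma density is concave in the rate, so its minimum over an interval of rates is
attained at an endpoint, and `λ_θ^*`, `λ_e^*` are the points where the endpoint densities cross
(`ite_gammaPDFReal_le`). Hence `h₁ h₂`, followed by the law of `ξ` given `λ`, is a common part of
mass `ε_B` (`minorant_le`, `minorant_real_univ`).
-/

/-! ### Quantitative convergence from a drift and a minorization condition -/

namespace DriftMinorization

/-- A function whose oscillation between any two points is at most `w s + w t` lies within `w` of
some constant. -/
lemma exists_abs_sub_le_of_sub_le {S : Type*} [Nonempty S] {u w : S → ℝ}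
    (huw : ∀ s t, u s - u t ≤ w s + w t) : ∃ k : ℝ, ∀ s, |u s - k| ≤ w s := by
  have hbdd : BddAbove (Set.range fun s => u s - w s) := by
    obtain ⟨t⟩ := ‹Nonempty S›
    exact ⟨u t + w t, by rintro _ ⟨s, rfl⟩; linarith [huw s t]⟩
  refine ⟨⨆ s, (u s - w s), fun s => abs_le.2 ⟨?_, ?_⟩⟩
  · have : (⨆ s, (u s - w s)) ≤ u s + w s := ciSup_le fun t => by linarith [huw t s]
    linarith
  · linarith [le_ciSup hbdd s]

variable {S : Type*} [MeasurableSpace S]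

/-- Two probability measures with a common part `κ` integrate a function `u` alike, up to the
oscillation of `u` over the remaining mass. This replaces the coupling that moves both chains by
`κ` simultaneously: only the residual measures `μᵢ - κ` see the oscillation. -/
lemma integral_sub_integral_le_of_common_part {μ₁ μ₂ κ : Measure S} [IsProbabilityMeasure μ₁]
    [IsProbabilityMeasure μ₂] (h1 : κ ≤ μ₁) (h2 : κ ≤ μ₂) {u V : S → ℝ} {A c : ℝ}
    (hu : Measurable u) (hu01 : ∀ s, u s ∈ Set.Icc (0 : ℝ) 1) (hV0 : ∀ s, 0 ≤ V s)
    (hV1 : Integrable V μ₁) (hV2 : Integrable V μ₂) (hc : 0 ≤ c)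
    (huV : ∀ s t, u s - u t ≤ A + c * (1 + V s + V t)) :
    ∫ s, u s ∂μ₁ - ∫ s, u s ∂μ₂ ≤
      (1 - κ.real Set.univ) * A + c * (1 + ∫ s, V s ∂μ₁ + ∫ s, V s ∂μ₂) := by
  have : Nonempty S := nonempty_of_isProbabilityMeasure μ₁
  have : IsFiniteMeasure κ := isFiniteMeasure_of_le μ₁ h1
  obtain ⟨k, hk⟩ := exists_abs_sub_le_of_sub_le (u := u)
    (w := fun s => A / 2 + c / 2 + c * V s) fun s t => by linarith [huV s t]
  have key : ∀ μ : Measure S, IsProbabilityMeasure μ → κ ≤ μ → Integrable V μ →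
      |∫ s, u s ∂μ - ∫ s, u s ∂κ - (1 - κ.real Set.univ) * k| ≤
        (1 - κ.real Set.univ) * (A / 2 + c / 2) + c * ∫ s, V s ∂μ := by
    intro μ hμ hle hV
    have hdec : μ - κ + κ = μ := Measure.sub_add_cancel_of_le hle
    have hρ : μ - κ ≤ μ := Measure.sub_le
    have : IsFiniteMeasure (μ - κ) := isFiniteMeasure_of_le μ hρ
    have huI : ∀ ν : Measure S, IsFiniteMeasure ν → Integrable u ν := fun ν _ =>
      Integrable.of_bound (C := 1) hu.aestronglyMeasurable
        (Filter.Eventually.of_forall fun s => by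
          rw [Real.norm_eq_abs, abs_of_nonneg (hu01 s).1]; exact (hu01 s).2)
    have hVρ : Integrable V (μ - κ) := hV.mono_measure hρ
    have hmass : (μ - κ).real Set.univ = 1 - κ.real Set.univ := by
      have hadd : (μ - κ + κ).real Set.univ = (μ - κ).real Set.univ + κ.real Set.univ :=
        measureReal_add_apply
      rw [hdec, probReal_univ] at hadd
      linarith
    have hsplit : ∫ s, u s ∂μ = ∫ s, u s ∂(μ - κ) + ∫ s, u s ∂κ := by
      conv_lhs => rw [← hdec]
      exact integral_add_measure (huI _ inferInstance) (huI _ inferInstance)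
    have hcenter : ∫ s, u s ∂μ - ∫ s, u s ∂κ - (1 - κ.real Set.univ) * k =
        ∫ s, (u s - k) ∂(μ - κ) := by
      rw [integral_sub (huI _ inferInstance) (integrable_const k), integral_const, hmass, hsplit,
        smul_eq_mul]
      ring
    rw [hcenter]
    calc |∫ s, (u s - k) ∂(μ - κ)| ≤ ∫ s, |u s - k| ∂(μ - κ) := abs_integral_le_integral_abs
      _ ≤ ∫ s, (A / 2 + c / 2 + c * V s) ∂(μ - κ) :=
          integral_mono ((huI _ inferInstance).sub (integrable_const k)).abs
            ((integrable_const _).add (hVρ.const_mul c)) hk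
      _ = (1 - κ.real Set.univ) * (A / 2 + c / 2) + c * ∫ s, V s ∂(μ - κ) := by
          rw [integral_add (integrable_const _) (hVρ.const_mul c), integral_const, hmass,
            integral_const_mul, smul_eq_mul]
      _ ≤ _ := by
          have : ∫ s, V s ∂(μ - κ) ≤ ∫ s, V s ∂μ :=
            integral_mono_measure hρ (Filter.Eventually.of_forall hV0) hV
          gcongr
  have k1 := (abs_le.1 (key μ₁ inferInstance h1 hV1)).2
  have k2 := (abs_le.1 (key μ₂ inferInstance h2 hV2)).1
  have hκ0 : 0 ≤ c * κ.real Set.univ := mul_nonneg hc measureReal_nonneg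
  nlinarith [k1, k2, hκ0]

/-- The operator `u ↦ P u`, `P u (x) = ∫ u dP(x, ·)`. -/
noncomputable def average (P : Kernel S S) (u : S → ℝ) (x : S) : ℝ := ∫ s, u s ∂(P x)

/-- The drift condition `P V ≤ γ V + b` for a nonnegative function `V`. -/
structure Drift (P : Kernel S S) (V : S → ℝ) (γ b : ℝ) : Prop where
  nonneg : ∀ x, 0 ≤ V x
  measurable : Measurable V
  integrable : ∀ x, Integrable V (P x)
  le : ∀ x, ∫ s, V s ∂(P x) ≤ γ * V x + b

variable {P : Kernel S S}

lemma measurable_average {u : S → ℝ} (hu : Measurable u) : Measurable (average P u) :=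
  (hu.stronglyMeasurable.integral_kernel (κ := P)).measurable

variable [IsMarkovKernel P]

lemma integrable_of_mem_Icc {μ : Measure S} [IsFiniteMeasure μ] {u : S → ℝ} {a : ℝ}
    (hu : Measurable u) (h : ∀ s, u s ∈ Set.Icc (0 : ℝ) a) : Integrable u μ :=
  Integrable.of_bound (C := a) hu.aestronglyMeasurable
    (Filter.Eventually.of_forall fun s => by
      rw [Real.norm_eq_abs, abs_of_nonneg (h s).1]; exact (h s).2)

lemma average_mem_Icc {u : S → ℝ} {a : ℝ} (hu : Measurable u)
    (h : ∀ s, u s ∈ Set.Icc (0 : ℝ) a) (x : S) : average P u x ∈ Set.Icc (0 : ℝ) a := by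
  refine ⟨integral_nonneg fun s => (h s).1, ?_⟩
  calc average P u x ≤ ∫ _, a ∂(P x) :=
        integral_mono (integrable_of_mem_Icc hu h) (integrable_const a) fun s => (h s).2
    _ = a := by simp

lemma iterate_average_spec {u : S → ℝ} {a : ℝ} (hu : Measurable u)
    (h : ∀ s, u s ∈ Set.Icc (0 : ℝ) a) (n : ℕ) :
    Measurable ((average P)^[n] u) ∧ ∀ s, (average P)^[n] u s ∈ Set.Icc (0 : ℝ) a := by
  induction n with
  | zero => exact ⟨hu, h⟩
  | succ n ih =>
    rw [Function.iterate_succ_apply']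
    exact ⟨measurable_average ih.1, average_mem_Icc ih.1 ih.2⟩

instance isMarkovKernel_pow (n : ℕ) : IsMarkovKernel (P ^ n) := by
  induction n with
  | zero => rw [pow_zero]; exact inferInstanceAs (IsMarkovKernel (Kernel.id : Kernel S S))
  | succ n ih => rw [pow_succ]; exact inferInstanceAs (IsMarkovKernel ((P ^ n) ∘ₖ P))

lemma iterate_average_eq_integral_pow {u : S → ℝ} {a : ℝ} (hu : Measurable u)
    (h : ∀ s, u s ∈ Set.Icc (0 : ℝ) a) (n : ℕ) (x : S) :
    (average P)^[n] u x = ∫ s, u s ∂((P ^ n) x) := by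
  induction n generalizing x with
  | zero =>
    have : (P ^ 0 : Kernel S S) = Kernel.id := pow_zero P
    rw [this, Kernel.id_apply, integral_dirac' _ _ hu.stronglyMeasurable]
    rfl
  | succ n ih =>
    have hcomp : P ^ (n + 1) = (P ^ n) ∘ₖ P := pow_succ P n
    rw [Function.iterate_succ_apply', hcomp,
      Kernel.integral_comp (integrable_of_mem_Icc hu h)]
    exact integral_congr_ae (Filter.Eventually.of_forall fun s => ih s)

lemma integral_iterate_average {π : Measure S} [IsProbabilityMeasure π] (hπ : P.Invariant π)
    {u : S → ℝ} {a : ℝ} (hu : Measurable u) (h : ∀ s, u s ∈ Set.Icc (0 : ℝ) a) (n : ℕ) :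
    ∫ s, (average P)^[n] u s ∂π = ∫ s, u s ∂π := by
  induction n with
  | zero => rfl
  | succ n ih =>
    obtain ⟨hm, hI⟩ := iterate_average_spec (P := P) hu h n
    rw [Function.iterate_succ_apply', ← ih]
    have hbind : (P ∘ₖ Kernel.const Unit π) () = π := by
      rw [Kernel.comp_apply, Kernel.const_apply]
      exact hπ
    have := Kernel.integral_comp (η := P) (κ := Kernel.const Unit π) (a := ())
      (integrable_of_mem_Icc hm hI)
    rw [hbind, Kernel.const_apply] at this
    exact this.symm

/-- Iterating the drift condition from a function that lies below `V`. -/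
lemma iterate_average_le_of_drift {V : S → ℝ} {γ b : ℝ} (hD : Drift P V γ b) (hγ0 : 0 ≤ γ)
    (hγ : γ < 1) {u : S → ℝ} {a : ℝ} (hu : Measurable u) (h : ∀ s, u s ∈ Set.Icc (0 : ℝ) a)
    (huV : ∀ s, u s ≤ V s) (n : ℕ) (x : S) :
    (average P)^[n] u x ≤ γ ^ n * V x + (1 - γ ^ n) * (b / (1 - γ)) := by
  induction n generalizing x with
  | zero => simpa using huV x
  | succ n ih =>
    obtain ⟨hm, hI⟩ := iterate_average_spec (P := P) hu h n
    rw [Function.iterate_succ_apply']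
    calc average P ((average P)^[n] u) x
        ≤ ∫ s, (γ ^ n * V s + (1 - γ ^ n) * (b / (1 - γ))) ∂(P x) :=
          integral_mono (integrable_of_mem_Icc hm hI)
            (((hD.integrable x).const_mul _).add (integrable_const _)) ih
      _ = γ ^ n * ∫ s, V s ∂(P x) + (1 - γ ^ n) * (b / (1 - γ)) := by
          rw [integral_add ((hD.integrable x).const_mul _) (integrable_const _),
            integral_const_mul, integral_const, probReal_univ, one_smul]
      _ ≤ γ ^ n * (γ * V x + b) + (1 - γ ^ n) * (b / (1 - γ)) := by
          gcongr
          exact hD.le x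
      _ = _ := by
          have : 1 - γ ≠ 0 := by linarith
          field_simp
          ring

/-- A stationary law integrates the drift function, with integral at most `b / (1 - γ)`. Since
integrability is not known beforehand, the drift is iterated on the truncations `min V a`. -/
lemma integral_drift_le {V : S → ℝ} {γ b : ℝ} (hD : Drift P V γ b) (hγ0 : 0 ≤ γ)
    (hγ : γ < 1) (hb : 0 ≤ b) {π : Measure S} [IsProbabilityMeasure π] (hπ : P.Invariant π) :
    Integrable V π ∧ ∫ s, V s ∂π ≤ b / (1 - γ) := by
  set B := b / (1 - γ) with hB
  have hB0 : 0 ≤ B := div_nonneg hb (by linarith)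
  have htrunc : ∀ a : ℕ, ∫ s, min (V s) a ∂π ≤ B := by
    intro a
    have hm : Measurable fun s => min (V s) (a : ℝ) := hD.measurable.min measurable_const
    have hI : ∀ s, min (V s) (a : ℝ) ∈ Set.Icc (0 : ℝ) a := fun s =>
      ⟨le_min (hD.nonneg s) (Nat.cast_nonneg a), min_le_right _ _⟩
    have hbound : ∀ n : ℕ, ∫ s, min (V s) (a : ℝ) ∂π ≤
        ∫ s, min (γ ^ n * V s + (1 - γ ^ n) * B) a ∂π := by
      intro n
      obtain ⟨hm', hI'⟩ := iterate_average_spec (P := P) hm hI n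
      rw [← integral_iterate_average hπ hm hI n]
      refine integral_mono (integrable_of_mem_Icc hm' hI')
        (integrable_of_mem_Icc (a := (a : ℝ)) ?_ fun s => ⟨le_min ?_ (Nat.cast_nonneg a),
          min_le_right _ _⟩) fun s => le_min ?_ (hI' s).2
      · exact ((hD.measurable.const_mul _).add_const _).min measurable_const
      · have := hD.nonneg s
        have : γ ^ n ≤ 1 := pow_le_one₀ hγ0 hγ.le
        have : 0 ≤ 1 - γ ^ n := by linarith
        positivity
      · exact iterate_average_le_of_drift hD hγ0 hγ hm hI (fun s => min_le_left _ _) n s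
    have hlim : Filter.Tendsto
        (fun n : ℕ => ∫ s, min (γ ^ n * V s + (1 - γ ^ n) * B) (a : ℝ) ∂π) Filter.atTop
        (nhds (∫ _, min B (a : ℝ) ∂π)) := by
      refine tendsto_integral_of_dominated_convergence (fun _ => (a : ℝ)) (fun n => ?_)
        (integrable_const _) (fun n => Filter.Eventually.of_forall fun s => ?_)
        (Filter.Eventually.of_forall fun s => ?_)
      · exact (((hD.measurable.const_mul _).add_const _).min
          measurable_const).aestronglyMeasurable
      · have := hD.nonneg s
        have : γ ^ n ≤ 1 := pow_le_one₀ hγ0 hγ.le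
        have : 0 ≤ 1 - γ ^ n := by linarith
        rw [Real.norm_eq_abs, abs_of_nonneg (le_min (by positivity) (Nat.cast_nonneg a))]
        exact min_le_right _ _
      · have h0 := tendsto_pow_atTop_nhds_zero_of_lt_one hγ0 hγ
        have h1 := (h0.mul_const (V s)).add ((h0.const_sub 1).mul_const B)
        simp only [zero_mul, sub_zero, one_mul, zero_add] at h1
        exact h1.min tendsto_const_nhds
    refine (ge_of_tendsto' hlim hbound).trans ?_
    rw [integral_const, probReal_univ, one_smul]
    exact min_le_left _ _
  have hlint : ∫⁻ s, ENNReal.ofReal (V s) ∂π ≤ ENNReal.ofReal B := by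
    have hsup : ∀ s, ENNReal.ofReal (V s) = ⨆ a : ℕ, ENNReal.ofReal (min (V s) a) := by
      intro s
      refine le_antisymm ?_ (iSup_le fun a => ENNReal.ofReal_le_ofReal (min_le_left _ _))
      obtain ⟨a, ha⟩ := exists_nat_ge (V s)
      exact le_iSup_of_le a (by rw [min_eq_left ha])
    simp_rw [hsup]
    rw [lintegral_iSup]
    · refine iSup_le fun a => ?_
      rw [← ofReal_integral_eq_lintegral_ofReal]
      · exact ENNReal.ofReal_le_ofReal (htrunc a)
      · exact integrable_of_mem_Icc (a := (a : ℝ)) (hD.measurable.min measurable_const) fun s =>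
          ⟨le_min (hD.nonneg s) (Nat.cast_nonneg a), min_le_right _ _⟩
      · exact Filter.Eventually.of_forall fun s => le_min (hD.nonneg s) (Nat.cast_nonneg a)
    · exact fun a => (hD.measurable.min measurable_const).ennreal_ofReal
    · intro a a' haa s
      exact ENNReal.ofReal_le_ofReal (min_le_min_left _ (by exact_mod_cast haa))
  have hint : Integrable V π :=
    ⟨hD.measurable.aestronglyMeasurable, by
      rw [hasFiniteIntegral_iff_ofReal (Filter.Eventually.of_forall hD.nonneg)]
      exact hlint.trans_lt ENNReal.ofReal_lt_top⟩
  refine ⟨hint, (ENNReal.ofReal_le_ofReal_iff hB0).1 ?_⟩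
  rwa [ofReal_integral_eq_lintegral_ofReal hint (Filter.Eventually.of_forall hD.nonneg)]

/-- The contraction estimate behind the convergence theorem. The number `j` is a free threshold
for the joint visits of two chains to `{V ≤ d}`. Each visit gains a factor `1 - κ(S)`, so more than
`j` of them give the first term; each step outside contracts `1 + V x + V y` by `α` while a visit
expands it by at most `U`, so at most `j` of them give the second. -/
theorem iterate_average_sub_le {V : S → ℝ} {γ b d : ℝ} (hD : Drift P V γ b) (hγ0 : 0 ≤ γ)
    (hγ : γ < 1) (hb : 0 ≤ b) (hd : 2 * b / (1 - γ) < d) {κ : Measure S}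
    (hκ : ∀ x, V x ≤ d → κ ≤ P x) (hκ1 : κ.real Set.univ ≤ 1)
    {α U : ℝ} (hα : α = (1 + d) / (1 + 2 * b + γ * d)) (hU : U = 1 + 2 * (γ * d + b))
    {u : S → ℝ} (hu : Measurable u) (hu01 : ∀ s, u s ∈ Set.Icc (0 : ℝ) 1) (n j : ℕ) (x y : S) :
    (average P)^[n] u x - (average P)^[n] u y ≤
      (1 - κ.real Set.univ) ^ (j + 1) + (α ^ n)⁻¹ * (α * U) ^ j * (1 + V x + V y) := by
  have hg : 0 < 1 - γ := by linarith
  have hd0 : 0 < d := lt_of_le_of_lt (by positivity) hd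
  have hd' : 2 * b < d * (1 - γ) := (div_lt_iff₀ hg).1 hd
  have hden : 0 < 1 + 2 * b + γ * d := by positivity
  have hα1 : 1 < α := by rw [hα, lt_div_iff₀ hden]; linarith
  have hU1 : 1 ≤ U := by rw [hU]; nlinarith [mul_nonneg hγ0 hd0.le]
  have hα0 : 0 < α := by linarith
  have hαU : 1 ≤ α * U := by nlinarith
  have hβ : 0 ≤ 1 - κ.real Set.univ := by linarith
  have hα' : α * (1 + 2 * b + γ * d) = 1 + d := by rw [hα]; field_simp
  induction n generalizing j x y with
  | zero =>
    have h1 := (hu01 x).2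
    have h2 := (hu01 y).1
    have h3 : 1 ≤ (α * U) ^ j := one_le_pow₀ hαU
    have h4 : 1 ≤ 1 + V x + V y := by linarith [hD.nonneg x, hD.nonneg y]
    have h5 : 0 ≤ (1 - κ.real Set.univ) ^ (j + 1) := by positivity
    simp only [Function.iterate_zero, id_eq, pow_zero, inv_one, one_mul]
    nlinarith
  | succ n ih =>
    obtain ⟨hm, hI⟩ := iterate_average_spec (P := P) hu hu01 n
    rw [Function.iterate_succ_apply']
    have hPV := add_le_add (hD.le x) (hD.le y)
    have hc : 0 ≤ (α ^ (n + 1))⁻¹ * (α * U) ^ j := by positivity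
    have hVx := hD.nonneg x
    have hVy := hD.nonneg y
    by_cases hxy : V x ≤ d ∧ V y ≤ d
    · have hκx := hκ x hxy.1
      have hκy := hκ y hxy.2
      cases j with
      | zero =>
        have := integral_sub_integral_le_of_common_part hκx hκy hm hI hD.nonneg
          (hD.integrable x) (hD.integrable y) (A := 1) le_rfl
          (fun s t => by linarith [(hI s).2, (hI t).1])
        simp only [average] at this ⊢
        rw [pow_zero, mul_one] at hc
        simp only [zero_add, pow_one, pow_zero, mul_one]
        nlinarith [mul_nonneg hc (show 0 ≤ 1 + V x + V y by positivity)]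
      | succ j =>
        have hc' : 0 ≤ (α ^ n)⁻¹ * (α * U) ^ j := by positivity
        have := integral_sub_integral_le_of_common_part hκx hκy hm hI hD.nonneg
          (hD.integrable x) (hD.integrable y) hc' (ih j)
        refine this.trans (add_le_add (by rw [pow_succ _ (j + 1)]; exact (mul_comm _ _).le) ?_)
        have e : (α ^ (n + 1))⁻¹ * (α * U) ^ (j + 1) = (α ^ n)⁻¹ * (α * U) ^ j * U := by
          rw [pow_succ α, pow_succ (α * U)]
          field_simp
        rw [e, mul_assoc _ U]
        refine mul_le_mul_of_nonneg_left ?_ hc'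
        have h1 : γ * V x ≤ γ * d := mul_le_mul_of_nonneg_left hxy.1 hγ0
        have h2 : γ * V y ≤ γ * d := mul_le_mul_of_nonneg_left hxy.2 hγ0
        calc _ ≤ U := by rw [hU]; linarith
          _ ≤ U * (1 + V x + V y) := by nlinarith
    · -- Outside `{V ≤ d} × {V ≤ d}` nothing is known about a common part, and `κ = 0` is used.
      have hc' : 0 ≤ (α ^ n)⁻¹ * (α * U) ^ j := by positivity
      have := integral_sub_integral_le_of_common_part (Measure.zero_le (P x))
        (Measure.zero_le (P y)) hm hI hD.nonneg (hD.integrable x) (hD.integrable y) hc' (ih j)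
      refine this.trans (add_le_add (by simp) ?_)
      have hw : d ≤ V x + V y := by
        by_contra hlt
        exact hxy ⟨by linarith, by linarith⟩
      have e : (α ^ (n + 1))⁻¹ * (α * U) ^ j = (α ^ n)⁻¹ * (α * U) ^ j * α⁻¹ := by
        rw [pow_succ, mul_inv]; ring
      rw [e, mul_assoc _ α⁻¹]
      refine mul_le_mul_of_nonneg_left ?_ hc'
      rw [inv_mul_eq_div, le_div_iff₀ hα0]
      have hαγ : α * γ ≤ 1 := by
        rw [hα, div_mul_eq_mul_div, div_le_one hden]
        nlinarith
      calc (1 + ∫ s, V s ∂(P x) + ∫ s, V s ∂(P y)) * α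
          ≤ (1 + 2 * b + γ * (V x + V y)) * α := mul_le_mul_of_nonneg_right (by linarith) hα0.le
        _ = (1 + d) + α * γ * (V x + V y - d) := by rw [← hα']; ring
        _ ≤ 1 + V x + V y := by nlinarith [mul_le_mul_of_nonneg_right hαγ (sub_nonneg.2 hw)]

/-- Convergence theorem for a chain with a drift and a minorization condition, tested on functions
with values in `[0, 1]`. -/
theorem abs_iterate_average_sub_integral_le {V : S → ℝ} {γ b d : ℝ} (hD : Drift P V γ b)
    (hγ0 : 0 ≤ γ) (hγ : γ < 1) (hb : 0 ≤ b) (hd : 2 * b / (1 - γ) < d) {κ : Measure S}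
    (hκ : ∀ x, V x ≤ d → κ ≤ P x) (hκ1 : κ.real Set.univ < 1)
    {α U : ℝ} (hα : α = (1 + d) / (1 + 2 * b + γ * d)) (hU : U = 1 + 2 * (γ * d + b))
    {π : Measure S} [IsProbabilityMeasure π] (hπ : P.Invariant π)
    {u : S → ℝ} (hu : Measurable u) (hu01 : ∀ s, u s ∈ Set.Icc (0 : ℝ) 1)
    {r : ℝ} (hr0 : 0 < r) (n : ℕ) (x : S) :
    |(average P)^[n] u x - ∫ s, u s ∂π| ≤
      (1 - κ.real Set.univ) ^ (r * n) +
        (U ^ r / α ^ (1 - r)) ^ n * (1 + b / (1 - γ) + V x) := by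
  obtain ⟨hVint, hVle⟩ := integral_drift_le hD hγ0 hγ hb hπ
  have hg : 0 < 1 - γ := by linarith
  have hd0 : 0 < d := lt_of_le_of_lt (by positivity) hd
  have hd' : 2 * b < d * (1 - γ) := (div_lt_iff₀ hg).1 hd
  have hden : 0 < 1 + 2 * b + γ * d := by positivity
  have hα1 : 1 < α := by rw [hα, lt_div_iff₀ hden]; linarith
  have hU1 : 1 ≤ U := by rw [hU]; nlinarith [mul_nonneg hγ0 hd0.le]
  have hα0 : 0 < α := by linarith
  have hU0 : 0 < U := by linarith
  have hβ : 0 < 1 - κ.real Set.univ := by linarith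
  have hβ1 : 1 - κ.real Set.univ ≤ 1 := by linarith [measureReal_nonneg (μ := κ) (s := Set.univ)]
  set j := ⌊r * n⌋₊ with hj
  have hrn : 0 ≤ r * n := by positivity
  -- The number of allowed visits `j + 1` brackets `r n`.
  have hA : (1 - κ.real Set.univ) ^ (j + 1) ≤ (1 - κ.real Set.univ) ^ (r * n) := by
    rw [← Real.rpow_natCast]
    refine Real.rpow_le_rpow_of_exponent_ge hβ hβ1 ?_
    push_cast
    exact (Nat.lt_floor_add_one _).le
  have hC : (α ^ n)⁻¹ * (α * U) ^ j ≤ (U ^ r / α ^ (1 - r)) ^ n := by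
    have h1 : (α * U) ^ j ≤ (α * U) ^ (r * n) := by
      rw [← Real.rpow_natCast]
      exact Real.rpow_le_rpow_of_exponent_le (by nlinarith) (Nat.floor_le hrn)
    have h2 : (U ^ r / α ^ (1 - r)) ^ n = (α ^ n)⁻¹ * (α * U) ^ (r * n) := by
      rw [Real.rpow_mul (by positivity), Real.rpow_natCast, ← inv_pow, ← mul_pow,
        Real.mul_rpow hα0.le hU0.le, Real.rpow_sub hα0, Real.rpow_one]
      congr 1
      field_simp
    rw [h2]
    gcongr
  obtain ⟨hm, hI⟩ := iterate_average_spec (P := P) hu hu01 n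
  set A := (1 - κ.real Set.univ) ^ (j + 1)
  set c := (α ^ n)⁻¹ * (α * U) ^ j with hc
  have hc0 : 0 ≤ c := by positivity
  have hint : Integrable ((average P)^[n] u) π := integrable_of_mem_Icc hm hI
  have hmaj : Integrable (fun s => A + c * (1 + V x + V s)) π :=
    (integrable_const _).add (((integrable_const _).add hVint).const_mul c)
  have hval : ∫ s, (A + c * (1 + V x + V s)) ∂π = A + c * (1 + V x + ∫ s, V s ∂π) := by
    have hadd : ∫ s, (A + c * (1 + V x + V s)) ∂π =
        ∫ _, A ∂π + ∫ s, c * (1 + V x + V s) ∂π :=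
      integral_add (integrable_const _) (((integrable_const _).add hVint).const_mul c)
    rw [hadd, integral_const_mul, integral_add (integrable_const _) hVint]
    simp
  have hfin : A + c * (1 + V x + ∫ s, V s ∂π) ≤ (1 - κ.real Set.univ) ^ (r * n) +
      (U ^ r / α ^ (1 - r)) ^ n * (1 + b / (1 - γ) + V x) := by
    have := hD.nonneg x
    have : 0 ≤ b / (1 - γ) := by positivity
    refine add_le_add hA (mul_le_mul hC (by linarith) ?_ (by positivity))
    have := integral_nonneg (μ := π) (f := V) hD.nonneg
    positivity
  refine le_trans ?_ hfin
  rw [← hval, ← integral_iterate_average hπ hu hu01 n]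
  have hsub : (average P)^[n] u x - ∫ s, (average P)^[n] u s ∂π =
      ∫ s, ((average P)^[n] u x - (average P)^[n] u s) ∂π := by
    rw [integral_sub (integrable_const _) hint]; simp
  rw [hsub]
  refine abs_integral_le_integral_abs.trans
    (integral_mono ((integrable_const _).sub hint).abs hmaj fun s => abs_le.2 ⟨?_, ?_⟩)
  · have := iterate_average_sub_le hD hγ0 hγ hb hd hκ hκ1.le hα hU hu hu01 n j s x
    dsimp only
    linarith
  · exact iterate_average_sub_le hD hγ0 hγ hb hd hκ hκ1.le hα hU hu hu01 n j x s

/-- Later times inherit the bound of time `n`, because `Pᴺ = Pⁿ Pᴺ⁻ⁿ` and `P` maps functions with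
values in `[0, 1]` to such functions without changing their stationary mean. -/
theorem tvDist_pow_le {V : S → ℝ} {γ b d : ℝ} (hD : Drift P V γ b)
    (hγ0 : 0 ≤ γ) (hγ : γ < 1) (hb : 0 ≤ b) (hd : 2 * b / (1 - γ) < d) {κ : Measure S}
    (hκ : ∀ x, V x ≤ d → κ ≤ P x) (hκ1 : κ.real Set.univ < 1)
    {α U : ℝ} (hα : α = (1 + d) / (1 + 2 * b + γ * d)) (hU : U = 1 + 2 * (γ * d + b))
    {π : Measure S} [IsProbabilityMeasure π] (hπ : P.Invariant π)
    {r : ℝ} (hr0 : 0 < r) {n N : ℕ} (hnN : n ≤ N) (x : S) :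
    RandomEffects.tvDist ((P ^ N) x) π ≤
      (1 - κ.real Set.univ) ^ (r * n) +
        (U ^ r / α ^ (1 - r)) ^ n * (1 + b / (1 - γ) + V x) := by
  have : Nonempty {A : Set S // MeasurableSet A} := ⟨⟨∅, MeasurableSet.empty⟩⟩
  refine ciSup_le fun ⟨A, hA⟩ => ?_
  have hu : Measurable (A.indicator (1 : S → ℝ)) := measurable_one.indicator hA
  have hu01 : ∀ s, A.indicator (1 : S → ℝ) s ∈ Set.Icc (0 : ℝ) 1 := fun s => by
    by_cases hs : s ∈ A <;> simp [hs]
  obtain ⟨hm, hI⟩ := iterate_average_spec (P := P) hu hu01 (N - n)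
  have key := abs_iterate_average_sub_integral_le hD hγ0 hγ hb hd hκ hκ1 hα hU hπ hm hI hr0 n x
  rw [← Function.iterate_add_apply, Nat.add_sub_cancel' hnN,
    integral_iterate_average hπ hu hu01, iterate_average_eq_integral_pow hu hu01,
    integral_indicator_one hA, integral_indicator_one hA] at key
  exact key

end DriftMinorization

/-! ### Gamma densities -/

namespace RandomEffects

lemma gammaPDFReal_of_nonpos {a r x : ℝ} (ha : 1 < a) (hx : x ≤ 0) : gammaPDFReal a r x = 0 := by
  unfold gammaPDFReal
  split_ifs with h
  · rw [le_antisymm hx h, Real.zero_rpow (by linarith)]; simp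
  · rfl

lemma measurable_gammaPDF (a r : ℝ) : Measurable (gammaPDF a r) :=
  (measurable_gammaPDFReal a r).ennreal_ofReal

lemma integrable_gammaPDFReal {a r : ℝ} (ha : 0 < a) (hr : 0 < r) :
    Integrable (gammaPDFReal a r) := by
  refine ⟨(measurable_gammaPDFReal a r).aestronglyMeasurable, ?_⟩
  rw [hasFiniteIntegral_iff_ofReal (Filter.Eventually.of_forall (gammaPDFReal_nonneg ha hr))]
  exact (lintegral_gammaPDF_eq_one ha hr).trans_lt ENNReal.one_lt_top

lemma integral_gammaPDFReal {a r : ℝ} (ha : 0 < a) (hr : 0 < r) :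
    ∫ x, gammaPDFReal a r x = 1 := by
  rw [integral_eq_lintegral_of_nonneg_ae
    (Filter.Eventually.of_forall (gammaPDFReal_nonneg ha hr))
    (measurable_gammaPDFReal a r).aestronglyMeasurable]
  exact (congrArg ENNReal.toReal (lintegral_gammaPDF_eq_one ha hr)).trans ENNReal.toReal_one

/-- The constant by which `x ^ p * exp (-s x)` times the `Gamma(a, r)` density differs from the
`Gamma(a + p, r + s)` density. -/
noncomputable def gammaConj (a r p s : ℝ) : ℝ :=
  r ^ a / Real.Gamma a / ((r + s) ^ (a + p) / Real.Gamma (a + p))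

lemma gammaConj_pos {a r p s : ℝ} (ha : 0 < a) (hap : 0 < a + p) (hr : 0 < r) (hs : 0 ≤ s) :
    0 < gammaConj a r p s := by
  have := Real.Gamma_pos_of_pos ha
  have := Real.Gamma_pos_of_pos hap
  have : 0 < r + s := by linarith
  unfold gammaConj
  positivity

/-- Gamma conjugacy. -/
lemma rpow_mul_exp_mul_gammaPDFReal {a r p s x : ℝ} (hap : 0 < a + p)
    (hr : 0 < r) (hs : 0 ≤ s) (hx : 0 < x) :
    x ^ p * Real.exp (-(s * x)) * gammaPDFReal a r x =
      gammaConj a r p s * gammaPDFReal (a + p) (r + s) x := by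
  have h2 := (Real.Gamma_pos_of_pos hap).ne'
  have h3 : (r + s) ^ (a + p) ≠ 0 := (Real.rpow_pos_of_pos (by linarith) _).ne'
  unfold gammaConj gammaPDFReal
  rw [if_pos hx.le, if_pos hx.le, show a + p - 1 = (a - 1) + p by ring, Real.rpow_add hx,
    show -((r + s) * x) = -(r * x) + -(s * x) by ring, Real.exp_add]
  field_simp

/-- The mean of `1 / x` under `Gamma(a, r)` is `r / (a - 1)`. -/
lemma lintegral_gammaPDFReal_mul_inv {a r : ℝ} (ha : 1 < a) (hr : 0 < r) :
    ∫⁻ x, ENNReal.ofReal (gammaPDFReal a r x) * ENNReal.ofReal x⁻¹ =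
      ENNReal.ofReal (r / (a - 1)) := by
  have ha' : 0 < a + -1 := by linarith
  have hconst : gammaConj a r (-1) 0 = r / (a - 1) := by
    have h1 : Real.Gamma a = (a - 1) * Real.Gamma (a - 1) := by
      have := Real.Gamma_add_one (s := a - 1) (by linarith)
      rwa [sub_add_cancel] at this
    have h2 := (Real.Gamma_pos_of_pos (show 0 < a - 1 by linarith)).ne'
    have h3 : r ^ (a - 1) ≠ 0 := (Real.rpow_pos_of_pos hr _).ne'
    have h4 : a - 1 ≠ 0 := by linarith
    have h5 : r ^ a = r ^ (a - 1) * r := by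
      rw [Real.rpow_sub hr, Real.rpow_one]; field_simp
    rw [gammaConj, add_zero, ← sub_eq_add_neg, h1, h5]
    field_simp
  have hpt : ∀ᵐ x : ℝ, ENNReal.ofReal (gammaPDFReal a r x) * ENNReal.ofReal x⁻¹ =
      ENNReal.ofReal (r / (a - 1)) * gammaPDF (a + -1) r x := by
    have hne : ∀ᵐ x : ℝ, x ≠ 0 := by simp [ae_iff, measure_singleton]
    filter_upwards [hne] with x hx
    rcases lt_or_gt_of_ne hx with hx | hx
    · rw [gammaPDFReal_of_nonpos ha hx.le, gammaPDF_of_neg hx]; simp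
    · have := rpow_mul_exp_mul_gammaPDFReal (a := a) ha' hr le_rfl hx
      rw [hconst, zero_mul, neg_zero, Real.exp_zero, mul_one, add_zero, Real.rpow_neg_one] at this
      have h0 : 0 ≤ r / (a - 1) := by
        have : 0 < a - 1 := by linarith
        positivity
      rw [mul_comm, ← ENNReal.ofReal_mul (by positivity), this, ENNReal.ofReal_mul h0]
      rfl
  rw [lintegral_congr_ae hpt, lintegral_const_mul' _ _ ENNReal.ofReal_ne_top,
    lintegral_gammaPDF_eq_one ha' hr, mul_one]

/-- Up to a factor free of `r`, the logarithm of the `Gamma(a, r)` density at `x` is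
`a log r - r x`. -/
lemma gammaPDFReal_eq_exp {a r x : ℝ} (hr : 0 < r) (hx : 0 < x) :
    gammaPDFReal a r x = x ^ (a - 1) / Real.Gamma a * Real.exp (a * Real.log r - r * x) := by
  unfold gammaPDFReal
  rw [if_pos hx.le, Real.rpow_def_of_pos hr, sub_eq_add_neg (a * Real.log r),
    Real.exp_add, mul_comm a]
  ring

/-- As a function of the rate, the logarithm of the Gamma density is concave, so on an interval of
rates the density at `x` is smallest at an endpoint; the two endpoint densities cross at
`a log (r₁ / r₀) / (r₁ - r₀)`. -/
lemma ite_gammaPDFReal_le {a r₀ r₁ r z x : ℝ} (ha : 1 < a) (h0 : 0 < r₀) (h01 : r₀ < r₁)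
    (hr : r ∈ Set.Icc r₀ r₁) (hz : z = a * (Real.log r₁ - Real.log r₀) / (r₁ - r₀)) :
    (if x < z then gammaPDFReal a r₀ x else gammaPDFReal a r₁ x) ≤ gammaPDFReal a r x := by
  rcases le_or_gt x 0 with hx | hx
  · simp [gammaPDFReal_of_nonpos ha hx]
  have hr0 : 0 < r := h0.trans_le hr.1
  have hG := Real.Gamma_pos_of_pos (show 0 < a by linarith)
  have hcoef : 0 ≤ x ^ (a - 1) / Real.Gamma a := by positivity
  have hd : 0 < r₁ - r₀ := by linarith
  have hcross : a * (Real.log r₁ - Real.log r₀) = z * (r₁ - r₀) := by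
    rw [hz]; field_simp
  set t := (r - r₀) / (r₁ - r₀) with ht
  have ht0 : 0 ≤ t := div_nonneg (by linarith [hr.1]) hd.le
  have ht1 : t ≤ 1 := (div_le_one hd).2 (by linarith [hr.2])
  have htr : r = (1 - t) * r₀ + t * r₁ := by
    have : t * (r₁ - r₀) = r - r₀ := by rw [ht]; field_simp
    linarith
  have hlog : (1 - t) * Real.log r₀ + t * Real.log r₁ ≤ Real.log r := by
    have := strictConcaveOn_log_Ioi.concaveOn.2 (Set.mem_Ioi.2 h0)
      (Set.mem_Ioi.2 (h0.trans h01)) (by linarith : 0 ≤ 1 - t) ht0 (by ring)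
    simp only [smul_eq_mul] at this
    rwa [← htr] at this
  have hlog' : a * ((1 - t) * Real.log r₀ + t * Real.log r₁) ≤ a * Real.log r :=
    mul_le_mul_of_nonneg_left hlog (by linarith)
  split_ifs with hxz
  · rw [gammaPDFReal_eq_exp h0 hx, gammaPDFReal_eq_exp hr0 hx]
    refine mul_le_mul_of_nonneg_left (Real.exp_le_exp.2 ?_) hcoef
    have : 0 ≤ t * ((z - x) * (r₁ - r₀)) :=
      mul_nonneg ht0 (mul_nonneg (by linarith) hd.le)
    have e : a * ((1 - t) * Real.log r₀ + t * Real.log r₁) =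
        a * Real.log r₀ + t * (z * (r₁ - r₀)) := by rw [← hcross]; ring
    rw [htr]
    rw [e] at hlog'
    rw [← htr]
    have e2 : r * x = r₀ * x + t * (x * (r₁ - r₀)) := by rw [htr]; ring
    linarith
  · rw [gammaPDFReal_eq_exp (h0.trans h01) hx, gammaPDFReal_eq_exp hr0 hx]
    refine mul_le_mul_of_nonneg_left (Real.exp_le_exp.2 ?_) hcoef
    have : 0 ≤ (1 - t) * ((x - z) * (r₁ - r₀)) :=
      mul_nonneg (by linarith) (mul_nonneg (by linarith) hd.le)
    have e : a * ((1 - t) * Real.log r₀ + t * Real.log r₁) =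
        a * Real.log r₁ - (1 - t) * (z * (r₁ - r₀)) := by rw [← hcross]; ring
    rw [e] at hlog'
    have e2 : r * x = r₁ * x - (1 - t) * (x * (r₁ - r₀)) := by rw [htr]; ring
    linarith

lemma gammaPDFReal_lt_of_cross_lt {a r₀ r₁ z x : ℝ} (ha : 1 < a) (h0 : 0 < r₀) (h01 : r₀ < r₁)
    (hz : z = a * (Real.log r₁ - Real.log r₀) / (r₁ - r₀)) (hx : 0 < x) (hxz : z < x) :
    gammaPDFReal a r₁ x < gammaPDFReal a r₀ x := by
  have hG := Real.Gamma_pos_of_pos (show 0 < a by linarith)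
  have hd : 0 < r₁ - r₀ := by linarith
  have hcross : a * (Real.log r₁ - Real.log r₀) = z * (r₁ - r₀) := by
    rw [hz]; field_simp
  rw [gammaPDFReal_eq_exp (h0.trans h01) hx, gammaPDFReal_eq_exp h0 hx]
  refine mul_lt_mul_of_pos_left (Real.exp_lt_exp.2 ?_) (by positivity)
  have := mul_pos (sub_pos.2 hxz) hd
  linarith

/-- The minimum of two distinct Gamma densities of the same shape has mass strictly between `0`
and `1`. -/
lemma integral_ite_gammaPDFReal {a r₀ r₁ z : ℝ} (ha : 1 < a) (h0 : 0 < r₀) (h01 : r₀ < r₁)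
    (hz : z = a * (Real.log r₁ - Real.log r₀) / (r₁ - r₀)) {f : ℝ → ℝ}
    (hf : f = fun x => if x < z then gammaPDFReal a r₀ x else gammaPDFReal a r₁ x) :
    Measurable f ∧ (∀ x, 0 ≤ f x) ∧ Integrable f ∧
      (∫ x in Set.Ioi (0 : ℝ), f x) = ∫ x, f x ∧ 0 < ∫ x, f x ∧ ∫ x, f x < 1 := by
  have ha0 : 0 < a := by linarith
  have h1 : 0 < r₁ := h0.trans h01
  have hm : Measurable f := by
    rw [hf]
    exact Measurable.ite measurableSet_Iio (measurable_gammaPDFReal _ _)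
      (measurable_gammaPDFReal _ _)
  have hnn : ∀ x, 0 ≤ f x := fun x => by
    rw [hf]; dsimp only
    split_ifs
    exacts [gammaPDFReal_nonneg ha0 h0 x, gammaPDFReal_nonneg ha0 h1 x]
  have hle : ∀ x, f x ≤ gammaPDFReal a r₀ x := fun x => by
    rw [hf]; exact ite_gammaPDFReal_le ha h0 h01 (Set.left_mem_Icc.2 h01.le) hz
  have hint : Integrable f := (integrable_gammaPDFReal ha0 h0).mono' hm.aestronglyMeasurable
    (Filter.Eventually.of_forall fun x => by
      rw [Real.norm_eq_abs, abs_of_nonneg (hnn x)]; exact hle x)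
  have hpos : ∀ x, 0 < x → 0 < f x := fun x hx => by
    rw [hf]; dsimp only
    split_ifs
    exacts [gammaPDFReal_pos ha0 h0 hx, gammaPDFReal_pos ha0 h1 hx]
  refine ⟨hm, hnn, hint, ?_, ?_, ?_⟩
  · refine setIntegral_eq_integral_of_forall_compl_eq_zero fun x hx => ?_
    exact le_antisymm ((hle x).trans (gammaPDFReal_of_nonpos ha (not_lt.1 hx)).le) (hnn x)
  · rw [integral_pos_iff_support_of_nonneg hnn hint]
    refine lt_of_lt_of_le ?_ (measure_mono (s := Set.Ioi (0 : ℝ)) fun x hx => (hpos x hx).ne')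
    simp
  · have hsub : Integrable fun x => gammaPDFReal a r₀ x - f x :=
      (integrable_gammaPDFReal ha0 h0).sub hint
    -- Beyond the crossing point `z` the minimum is strictly below the `Gamma(a, r₀)` density.
    have : 0 < ∫ x, (gammaPDFReal a r₀ x - f x) := by
      rw [integral_pos_iff_support_of_nonneg (fun x => sub_nonneg.2 (hle x)) hsub]
      refine lt_of_lt_of_le ?_ (measure_mono (s := Set.Ioi (max 0 z)) fun x hx => ?_)
      · simp
      · have hx0 : 0 < x := (le_max_left _ _).trans_lt hx
        have hxz : z < x := (le_max_right _ _).trans_lt hx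
        have hfx : f x = gammaPDFReal a r₁ x := by rw [hf]; exact if_neg hxz.le.not_gt
        have := gammaPDFReal_lt_of_cross_lt ha h0 h01 hz hx0 hxz
        rw [← hfx] at this
        exact (sub_pos.2 this).ne'
    rw [integral_sub (integrable_gammaPDFReal ha0 h0) hint, integral_gammaPDFReal ha0 h0] at this
    linarith

/-! ### Gaussian densities and moments -/

lemma gaussianPDFReal_toNNReal_inv {p : ℝ} (hp : 0 < p) (μ x : ℝ) :
    gaussianPDFReal μ (Real.toNNReal p⁻¹) x =
      Real.sqrt (p / (2 * Real.pi)) * Real.exp (-(p * (x - μ) ^ 2 / 2)) := by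
  have h : ((Real.toNNReal p⁻¹ : NNReal) : ℝ) = p⁻¹ := Real.coe_toNNReal _ (by positivity)
  rw [gaussianPDFReal, h, ← Real.sqrt_inv]
  congr 2
  · field_simp
  · field_simp

lemma gaussianPDFReal_toNNReal_inv_of_nonpos {p : ℝ} (hp : p ≤ 0) (μ x : ℝ) :
    gaussianPDFReal μ (Real.toNNReal p⁻¹) x = 0 := by
  rw [Real.toNNReal_of_nonpos (inv_nonpos.2 hp), gaussianPDFReal_zero_var]; rfl

lemma toNNReal_inv_ne_zero {p : ℝ} (hp : 0 < p) : Real.toNNReal p⁻¹ ≠ 0 :=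
  (Real.toNNReal_pos.2 (inv_pos.2 hp)).ne'

/-- The second moment of `N(μ, 1/p)` about `c`. -/
lemma lintegral_sq_sub_gaussianReal {p : ℝ} (hp : 0 < p) (μ c : ℝ) :
    ∫⁻ x, ENNReal.ofReal ((x - c) ^ 2) ∂(gaussianReal μ (Real.toNNReal p⁻¹)) =
      ENNReal.ofReal (p⁻¹ + (μ - c) ^ 2) := by
  set G := gaussianReal μ (Real.toNNReal p⁻¹)
  have hL : MemLp (fun x : ℝ => x - c) 2 G := (memLp_id_gaussianReal 2).sub (memLp_const c)
  have hint : Integrable (fun x : ℝ => (x - c) ^ 2) G := hL.integrable_sq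
  have hvar := variance_eq_sub hL
  have hid : Integrable (fun x : ℝ => x) G :=
    (memLp_id_gaussianReal 1).integrable le_rfl
  have hmean : ∫ x, (x - c) ∂G = μ - c := by
    rw [integral_sub hid (integrable_const c), integral_id_gaussianReal]; simp
  have hv : variance (fun x : ℝ => x - c) G = p⁻¹ := by
    have := variance_sub_const (μ := G) (X := fun x : ℝ => x)
      hid.aestronglyMeasurable c
    rw [this, variance_fun_id_gaussianReal, Real.coe_toNNReal _ (by positivity)]
  rw [← ofReal_integral_eq_lintegral_ofReal hint
    (Filter.Eventually.of_forall fun x => sq_nonneg _)]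
  congr 1
  rw [hv, hmean] at hvar
  simp only [Pi.pow_apply] at hvar
  linarith

lemma withDensity_prod_gaussianPDFReal {K : ℕ} (w : Fin K → ℝ) {v : NNReal} (hv : v ≠ 0) :
    (volume : Measure (Fin K → ℝ)).withDensity
        (fun θ => ENNReal.ofReal (∏ i, gaussianPDFReal (w i) v (θ i))) =
      Measure.pi fun i => gaussianReal (w i) v := by
  refine (Measure.pi_eq fun s hs => ?_).symm
  have hnn : ∀ i x, 0 ≤ (s i).indicator (gaussianPDFReal (w i) v) x := fun i x =>
    Set.indicator_nonneg (fun _ _ => gaussianPDFReal_nonneg _ _ _) x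
  have hint : ∀ i, Integrable ((s i).indicator (gaussianPDFReal (w i) v)) := fun i =>
    (integrable_gaussianPDFReal _ _).indicator (hs i)
  have hind : ∀ θ : Fin K → ℝ, (Set.univ.pi s).indicator
      (fun θ => ENNReal.ofReal (∏ i, gaussianPDFReal (w i) v (θ i))) θ =
        ENNReal.ofReal (∏ i, (s i).indicator (gaussianPDFReal (w i) v) (θ i)) := by
    intro θ
    by_cases hθ : θ ∈ Set.univ.pi s
    · rw [Set.indicator_of_mem hθ]
      congr 1
      exact Finset.prod_congr rfl fun i _ =>
        (Set.indicator_of_mem (hθ i (Set.mem_univ i)) _).symm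
    · rw [Set.indicator_of_notMem hθ]
      simp only [Set.mem_pi, Set.mem_univ, true_implies, not_forall] at hθ
      obtain ⟨i, hi⟩ := hθ
      rw [Finset.prod_eq_zero (Finset.mem_univ i) (Set.indicator_of_notMem hi _)]
      simp
  rw [withDensity_apply _ (MeasurableSet.univ_pi hs),
    ← lintegral_indicator (MeasurableSet.univ_pi hs), lintegral_congr hind,
    ← ofReal_integral_eq_lintegral_ofReal, integral_fintype_prod_volume_eq_prod
      (fun i => (s i).indicator (gaussianPDFReal (w i) v)), ENNReal.ofReal_prod_of_nonneg]
  · refine Finset.prod_congr rfl fun i _ => ?_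
    rw [gaussianReal_apply_eq_integral _ hv, integral_indicator (hs i)]
  · exact fun i _ => integral_nonneg (hnn i)
  · exact Integrable.fintype_prod_dep hint
  · exact Filter.Eventually.of_forall fun θ => Finset.prod_nonneg fun i _ => hnn i _

/-! ### The two factorizations of the joint density -/

variable {K m : ℕ}

lemma prod_gaussianPDFReal {ι : Type*} [Fintype ι] {p : ℝ} (hp : 0 < p) (μ x : ι → ℝ) :
    ∏ i, gaussianPDFReal (μ i) (Real.toNNReal p⁻¹) (x i) =
      Real.sqrt (p / (2 * Real.pi)) ^ Fintype.card ι *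
        Real.exp (-(p * (∑ i, (x i - μ i) ^ 2) / 2)) := by
  simp_rw [gaussianPDFReal_toNNReal_inv hp]
  rw [Finset.prod_mul_distrib, Finset.prod_const, ← Real.exp_sum, Finset.card_univ]
  congr 2
  rw [Finset.mul_sum, Finset.sum_div, Finset.sum_neg_distrib]

lemma sum_sq_sub_eq {n : ℕ} (hn : n ≠ 0) (x : Fin n → ℝ) (t : ℝ) :
    ∑ j, (x j - t) ^ 2 = ∑ j, (x j - (∑ j, x j) / n) ^ 2 + n * (t - (∑ j, x j) / n) ^ 2 := by
  have hn' : (n : ℝ) ≠ 0 := by exact_mod_cast hn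
  set a := (∑ j, x j) / n with ha
  have hsum : ∑ j, (x j - a) = 0 := by
    rw [Finset.sum_sub_distrib, Finset.sum_const, Finset.card_univ, Fintype.card_fin, nsmul_eq_mul,
      ha]
    field_simp
    ring
  have : ∀ j, (x j - t) ^ 2 = (x j - a) ^ 2 + (t - a) ^ 2 - 2 * (t - a) * (x j - a) := fun j => by
    ring
  simp_rw [this]
  rw [Finset.sum_sub_distrib, Finset.sum_add_distrib, ← Finset.mul_sum, hsum, Finset.sum_const,
    Finset.card_univ, Fintype.card_fin, nsmul_eq_mul]
  ring

/-- The within/between decomposition of the residual sum of squares. -/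
lemma sum_sum_sq_sub_eq (hm : m ≠ 0) (y : Fin K → Fin m → ℝ) (θ : Fin K → ℝ) :
    ∑ i, ∑ j, (y i j - θ i) ^ 2 = SSE y + v₂ y θ := by
  rw [SSE, v₂, ← Finset.sum_add_distrib]
  exact Finset.sum_congr rfl fun i _ => sum_sq_sub_eq hm (y i) (θ i)

lemma sqrt_div_two_pi_pow {p : ℝ} (hp : 0 < p) (n : ℕ) :
    Real.sqrt (p / (2 * Real.pi)) ^ n =
      Real.sqrt (1 / (2 * Real.pi)) ^ n * p ^ ((n : ℝ) / 2) := by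
  have h1 : p / (2 * Real.pi) = 1 / (2 * Real.pi) * p := by ring
  rw [h1, Real.sqrt_mul (by positivity), mul_pow, Real.sqrt_eq_rpow p, ← Real.rpow_natCast (p ^ _),
    ← Real.rpow_mul hp.le]
  congr 2
  ring

/-- The normalising constant `(2π)^(-n/2)`. -/
noncomputable def gaussNorm (n : ℕ) : ℝ := Real.sqrt (1 / (2 * Real.pi)) ^ n

lemma gaussNorm_pos (n : ℕ) : 0 < gaussNorm n := by unfold gaussNorm; positivity

lemma prod_gaussianPDFReal_theta {l : Prec} (h1 : 0 < l.1) (ξ : Loc K) :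
    ∏ i, gaussianPDFReal ξ.2 (Real.toNNReal (l.1)⁻¹) (ξ.1 i) =
      gaussNorm K * (l.1 ^ ((K : ℝ) / 2) * Real.exp (-(v₁ ξ / 2 * l.1))) := by
  rw [prod_gaussianPDFReal h1 (fun _ => ξ.2) ξ.1, Fintype.card_fin, sqrt_div_two_pi_pow h1,
    mul_assoc, gaussNorm, v₁]
  congr 3
  ring

lemma jointDensityReal_eq (hm : m ≠ 0) (y : Fin K → Fin m → ℝ) (h : Prior) (s₀ : ℝ) {l : Prec}
    (h1 : 0 < l.1) (h2 : 0 < l.2) (ξ : Loc K) :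
    jointDensityReal y h s₀ l ξ =
      gaussNorm (m * K) * gaussNorm K *
        gaussianPDFReal h.m₀ (Real.toNNReal s₀⁻¹) ξ.2 *
        (l.1 ^ ((K : ℝ) / 2) * Real.exp (-(v₁ ξ / 2 * l.1)) * gammaPDFReal h.a₁ h.b₁ l.1) *
        (l.2 ^ (total K m / 2) * Real.exp (-((SSE y + v₂ y ξ.1) / 2 * l.2)) *
          gammaPDFReal h.a₂ h.b₂ l.2) := by
  have hy : ∏ i, ∏ j, gaussianPDFReal (ξ.1 i) (Real.toNNReal (l.2)⁻¹) (y i j) =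
      gaussNorm (m * K) * (l.2 ^ (total K m / 2) *
        Real.exp (-((SSE y + v₂ y ξ.1) / 2 * l.2))) := by
    have : ∀ i, ∏ j, gaussianPDFReal (ξ.1 i) (Real.toNNReal (l.2)⁻¹) (y i j) =
        Real.sqrt (l.2 / (2 * Real.pi)) ^ m *
          Real.exp (-(l.2 * (∑ j, (y i j - ξ.1 i) ^ 2) / 2)) := fun i => by
      rw [prod_gaussianPDFReal h2 (fun _ => ξ.1 i) (y i), Fintype.card_fin]
    simp_rw [this]
    rw [Finset.prod_mul_distrib, Finset.prod_const, ← Real.exp_sum, Finset.card_univ,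
      Fintype.card_fin, ← pow_mul, sqrt_div_two_pi_pow h2, ← sum_sum_sq_sub_eq hm y ξ.1, mul_assoc,
      gaussNorm, total]
    push_cast
    congr 3
    rw [Finset.sum_neg_distrib, ← Finset.sum_div, ← Finset.mul_sum]
    ring
  rw [jointDensityReal, hy, prod_gaussianPDFReal_theta h1]
  ring

/-- Both precisions carry a variance-zero Gaussian factor when they are not positive. -/
lemma jointDensityReal_eq_zero (hK : K ≠ 0) (hm : m ≠ 0) (y : Fin K → Fin m → ℝ) (h : Prior)
    (s₀ : ℝ) {l : Prec} (hl : ¬(0 < l.1 ∧ 0 < l.2)) (ξ : Loc K) :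
    jointDensityReal y h s₀ l ξ = 0 := by
  let i₀ : Fin K := ⟨0, Nat.pos_of_ne_zero hK⟩
  let j₀ : Fin m := ⟨0, Nat.pos_of_ne_zero hm⟩
  rw [jointDensityReal]
  by_cases h1 : 0 < l.1
  · have h2 : l.2 ≤ 0 := not_lt.1 fun h2 => hl ⟨h1, h2⟩
    rw [Finset.prod_eq_zero (Finset.mem_univ i₀) (Finset.prod_eq_zero (Finset.mem_univ j₀)
      (gaussianPDFReal_toNNReal_inv_of_nonpos h2 _ _))]
    ring
  · rw [Finset.prod_eq_zero (s := Finset.univ)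
      (f := fun i => gaussianPDFReal ξ.2 (Real.toNNReal (l.1)⁻¹) (ξ.1 i)) (Finset.mem_univ i₀)
      (gaussianPDFReal_toNNReal_inv_of_nonpos (not_lt.1 h1) _ _)]
    ring

/-- The conditional density of `λ` given `ξ`: independent Gamma laws. -/
noncomputable def precDensity (y : Fin K → Fin m → ℝ) (h : Prior) (ξ : Loc K) (l : Prec) : ℝ :=
  gammaPDFReal (K / 2 + h.a₁) (v₁ ξ / 2 + h.b₁) l.1 *
    gammaPDFReal (total K m / 2 + h.a₂) ((SSE y + v₂ y ξ.1) / 2 + h.b₂) l.2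

/-- The conditional precision of `μ` given `λ` under a flat prior for `μ`; the prior
`N(m₀, 1/s₀)` adds `s₀` to it. -/
noncomputable def flatPrec (K m : ℕ) (l : Prec) : ℝ :=
  K * (l.1 * (m * l.2) / (l.1 + m * l.2))

/-- The conditional mean of `μ` given `λ`, a weighted mean of `m₀` and `ȳ`. -/
noncomputable def muMean (y : Fin K → Fin m → ℝ) (h : Prior) (s₀ : ℝ) (l : Prec) : ℝ :=
  (s₀ * h.m₀ + flatPrec K m l * grandMean y) / (s₀ + flatPrec K m l)

/-- The conditional mean of `θ_i` given `λ` and `μ`, a weighted mean of `μ` and `ȳ_i`. -/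
noncomputable def thetaMean (y : Fin K → Fin m → ℝ) (l : Prec) (μ : ℝ) (i : Fin K) : ℝ :=
  (l.1 * μ + m * l.2 * cellMean y i) / (l.1 + m * l.2)

/-- The law of `ξ = (θ, μ)` with `μ ∼ N(ν, 1/p)` and, given `μ`, independent
`θ_i ∼ N(w(μ)_i, 1/q)`. -/
noncomputable def hierDensity (ν p q : ℝ) (w : ℝ → Fin K → ℝ) (ξ : Loc K) : ℝ :=
  gaussianPDFReal ν (Real.toNNReal p⁻¹) ξ.2 *
    ∏ i, gaussianPDFReal (w ξ.2 i) (Real.toNNReal q⁻¹) (ξ.1 i)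

lemma hierDensity_nonneg (ν p q : ℝ) (w : ℝ → Fin K → ℝ) (ξ : Loc K) :
    0 ≤ hierDensity ν p q w ξ :=
  mul_nonneg (gaussianPDFReal_nonneg _ _ _)
    (Finset.prod_nonneg fun _ _ => gaussianPDFReal_nonneg _ _ _)

lemma measurable_hierDensity (ν p q : ℝ) {w : ℝ → Fin K → ℝ} (hw : Measurable w) :
    Measurable (hierDensity ν p q w) := by
  have hG : Measurable (fun z : ℝ × ℝ => gaussianPDFReal z.1 (Real.toNNReal q⁻¹) z.2) := by
    unfold gaussianPDFReal
    fun_prop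
  have h2 : Measurable fun ξ : Loc K => gaussianPDFReal ν (Real.toNNReal p⁻¹) ξ.2 :=
    (measurable_gaussianPDFReal _ _).comp measurable_snd
  have h1 : ∀ i, Measurable fun ξ : Loc K =>
      gaussianPDFReal (w ξ.2 i) (Real.toNNReal q⁻¹) (ξ.1 i) := fun i =>
    hG.comp (f := fun ξ : Loc K => (w ξ.2 i, ξ.1 i))
      (((measurable_pi_apply i).comp (hw.comp measurable_snd)).prodMk
        ((measurable_pi_apply i).comp measurable_fst))
  unfold hierDensity
  exact h2.mul (Finset.measurable_prod _ fun i _ => h1 i)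

/-- Integration against a hierarchical Gaussian density, one layer at a time. -/
lemma lintegral_hierDensity_mul {ν p q : ℝ} (hp : 0 < p) (hq : 0 < q) {w : ℝ → Fin K → ℝ}
    (hw : Measurable w) {f : Loc K → ℝ≥0∞} (hf : Measurable f) :
    ∫⁻ ξ, ENNReal.ofReal (hierDensity ν p q w ξ) * f ξ =
      ∫⁻ μ, ∫⁻ θ, f (θ, μ) ∂(Measure.pi fun i => gaussianReal (w μ i) (Real.toNNReal q⁻¹))
        ∂(gaussianReal ν (Real.toNNReal p⁻¹)) := by
  have hmeas := (measurable_hierDensity ν p q hw).ennreal_ofReal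
  have hinner : ∀ μ : ℝ, ∫⁻ θ, ENNReal.ofReal (hierDensity ν p q w (θ, μ)) * f (θ, μ) =
      gaussianPDF ν (Real.toNNReal p⁻¹) μ *
        ∫⁻ θ, f (θ, μ) ∂(Measure.pi fun i => gaussianReal (w μ i) (Real.toNNReal q⁻¹)) := by
    intro μ
    have hfμ : Measurable fun θ : Fin K → ℝ => f (θ, μ) := hf.comp measurable_prodMk_right
    have hprod : Measurable fun θ : Fin K → ℝ =>
        ENNReal.ofReal (∏ i, gaussianPDFReal (w μ i) (Real.toNNReal q⁻¹) (θ i)) :=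
      (Finset.measurable_prod _ fun i _ => (measurable_gaussianPDFReal _ _).comp
        (measurable_pi_apply i)).ennreal_ofReal
    rw [← withDensity_prod_gaussianPDFReal (w μ) (toNNReal_inv_ne_zero hq),
      lintegral_withDensity_eq_lintegral_mul _ hprod hfμ,
      ← lintegral_const_mul _ (hprod.mul hfμ)]
    refine lintegral_congr fun θ => ?_
    rw [hierDensity, ENNReal.ofReal_mul (gaussianPDFReal_nonneg _ _ _), mul_assoc]
    rfl
  rw [Measure.volume_eq_prod, lintegral_prod_symm'
      (fun ξ : Loc K => ENNReal.ofReal (hierDensity ν p q w ξ) * f ξ) (hmeas.mul hf),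
    gaussianReal_of_var_ne_zero _ (toNNReal_inv_ne_zero hp)]
  rw [lintegral_withDensity_eq_lintegral_mul_non_measurable _ (measurable_gaussianPDF _ _)
    (Filter.Eventually.of_forall fun _ => gaussianPDF_lt_top)]
  exact lintegral_congr hinner

lemma lintegral_hierDensity {ν p q : ℝ} (hp : 0 < p) (hq : 0 < q) {w : ℝ → Fin K → ℝ}
    (hw : Measurable w) : ∫⁻ ξ, ENNReal.ofReal (hierDensity ν p q w ξ) = 1 := by
  have := lintegral_hierDensity_mul (ν := ν) hp hq hw (f := fun _ => 1) measurable_const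
  simpa using this

lemma measurable_thetaMean (y : Fin K → Fin m → ℝ) (l : Prec) : Measurable (thetaMean y l) := by
  unfold thetaMean
  exact measurable_pi_lambda _ fun i => by fun_prop

/-- The conditional density of `ξ` given `λ`. -/
noncomputable def locDensity (y : Fin K → Fin m → ℝ) (h : Prior) (s₀ : ℝ) (l : Prec) : Loc K → ℝ :=
  hierDensity (muMean y h s₀ l) (s₀ + flatPrec K m l) (l.1 + m * l.2) (thetaMean y l)

lemma hierDensity_eq {ν p q : ℝ} (hp : 0 < p) (hq : 0 < q) (w : ℝ → Fin K → ℝ) (ξ : Loc K) :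
    hierDensity ν p q w ξ = Real.sqrt (p / (2 * Real.pi)) * Real.sqrt (q / (2 * Real.pi)) ^ K *
      Real.exp (-((p * (ξ.2 - ν) ^ 2 + q * ∑ i, (ξ.1 i - w ξ.2 i) ^ 2) / 2)) := by
  rw [hierDensity, prod_gaussianPDFReal hq, gaussianPDFReal_toNNReal_inv hp, Fintype.card_fin,
    show -((p * (ξ.2 - ν) ^ 2 + q * ∑ i, (ξ.1 i - w ξ.2 i) ^ 2) / 2) =
      -(p * (ξ.2 - ν) ^ 2 / 2) + -(q * (∑ i, (ξ.1 i - w ξ.2 i) ^ 2) / 2) by ring, Real.exp_add]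
  ring

lemma flatPrec_pos (hK : K ≠ 0) (hm : m ≠ 0) {l : Prec} (h1 : 0 < l.1) (h2 : 0 < l.2) :
    0 < flatPrec K m l := by
  have : (0 : ℝ) < K := by exact_mod_cast Nat.pos_of_ne_zero hK
  have : (0 : ℝ) < m := by exact_mod_cast Nat.pos_of_ne_zero hm
  unfold flatPrec
  positivity

/-- For fixed `ξ` the joint density is proportional to a product of Gamma densities in `λ`. -/
lemma exists_jointDensityReal_eq_precDensity (hK : 3 ≤ K) (hm : 2 ≤ m) (y : Fin K → Fin m → ℝ)
    {h : Prior} (hh : h.Proper) {s₀ : ℝ} (hs : 0 < s₀) (ξ : Loc K) :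
    ∃ C : ℝ, 0 < C ∧ ∀ l, jointDensityReal y h s₀ l ξ = C * precDensity y h ξ l := by
  obtain ⟨ha1, hb1, ha2, hb2⟩ := hh
  have hK' : (3 : ℝ) ≤ K := by exact_mod_cast hK
  have hm' : (2 : ℝ) ≤ m := by exact_mod_cast hm
  have hM : 6 ≤ total K m := by unfold total; nlinarith
  have hv1 : 0 ≤ v₁ ξ / 2 := by unfold v₁; positivity
  have hv2 : 0 ≤ (SSE y + v₂ y ξ.1) / 2 := by unfold SSE v₂; positivity
  refine ⟨gaussNorm (m * K) * gaussNorm K * gaussianPDFReal h.m₀ (Real.toNNReal s₀⁻¹) ξ.2 *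
    gammaConj h.a₁ h.b₁ (K / 2) (v₁ ξ / 2) *
    gammaConj h.a₂ h.b₂ (total K m / 2) ((SSE y + v₂ y ξ.1) / 2), ?_, fun l => ?_⟩
  · have := gaussNorm_pos (m * K)
    have := gaussNorm_pos K
    have := gaussianPDFReal_pos h.m₀ _ ξ.2 (toNNReal_inv_ne_zero hs)
    have := gammaConj_pos (p := K / 2) ha1 (by positivity) hb1 hv1
    have := gammaConj_pos (p := total K m / 2) ha2 (by positivity) hb2 hv2
    positivity
  · by_cases hl : 0 < l.1 ∧ 0 < l.2
    · rw [jointDensityReal_eq (by omega) y h s₀ hl.1 hl.2,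
        rpow_mul_exp_mul_gammaPDFReal (by positivity) hb1 hv1 hl.1,
        rpow_mul_exp_mul_gammaPDFReal (by positivity) hb2 hv2 hl.2, precDensity,
        add_comm h.a₁, add_comm h.b₁, add_comm h.a₂, add_comm h.b₂]
      ring
    · rw [jointDensityReal_eq_zero (by omega) (by omega) y h s₀ hl, precDensity]
      by_cases h1 : 0 < l.1
      · rw [gammaPDFReal_of_nonpos (x := l.2) (by linarith) (not_lt.1 fun h2 => hl ⟨h1, h2⟩)]
        ring
      · rw [gammaPDFReal_of_nonpos (x := l.1) (by linarith) (not_lt.1 h1)]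
        ring

/-- For fixed `λ` the joint density is proportional to a hierarchical Gaussian density in `ξ`;
the squares are completed first in each `θ_i`, then in `μ`. -/
lemma exists_jointDensityReal_eq_locDensity (hK : 3 ≤ K) (hm : 2 ≤ m) (y : Fin K → Fin m → ℝ)
    {h : Prior} (hh : h.Proper) {s₀ : ℝ} (hs : 0 < s₀) {l : Prec} (h1 : 0 < l.1)
    (h2 : 0 < l.2) :
    ∃ C : ℝ, 0 < C ∧ ∀ ξ, jointDensityReal y h s₀ l ξ = C * locDensity y h s₀ l ξ := by
  obtain ⟨ha1, hb1, ha2, hb2⟩ := hh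
  have hm0 : (0 : ℝ) < m := by exact_mod_cast (show 0 < m by omega)
  have hK0 : (0 : ℝ) < K := by exact_mod_cast (show 0 < K by omega)
  have hq : 0 < l.1 + m * l.2 := by positivity
  have ht := flatPrec_pos (K := K) (m := m) (by omega) (by omega) h1 h2
  have hp : 0 < s₀ + flatPrec K m l := by positivity
  set q := l.1 + m * l.2 with hqdef
  set t := flatPrec K m l with htdef
  have htq : t = K * (l.1 * (m * l.2) / q) := rfl
  set D : ℝ := l.2 * SSE y + l.1 * (m * l.2) / q * ∑ i, (cellMean y i - grandMean y) ^ 2 +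
    s₀ * t / (s₀ + t) * (grandMean y - h.m₀) ^ 2 with hD
  have hquad : ∀ ξ : Loc K, s₀ * (ξ.2 - h.m₀) ^ 2 + l.1 * v₁ ξ + l.2 * (SSE y + v₂ y ξ.1) =
      ((s₀ + t) * (ξ.2 - muMean y h s₀ l) ^ 2 + q * ∑ i, (ξ.1 i - thetaMean y l ξ.2 i) ^ 2) +
        D := by
    intro ξ
    have hθ : ∀ i, l.1 * (ξ.1 i - ξ.2) ^ 2 + m * l.2 * (ξ.1 i - cellMean y i) ^ 2 =
        q * (ξ.1 i - thetaMean y l ξ.2 i) ^ 2 +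
          l.1 * (m * l.2) / q * (cellMean y i - ξ.2) ^ 2 := by
      intro i
      have : thetaMean y l ξ.2 i = (l.1 * ξ.2 + m * l.2 * cellMean y i) / q := rfl
      rw [this]
      have hq' : q ≠ 0 := hq.ne'
      field_simp
      rw [hqdef]
      ring
    have hsumθ : l.1 * v₁ ξ + l.2 * v₂ y ξ.1 = q * ∑ i, (ξ.1 i - thetaMean y l ξ.2 i) ^ 2 +
        l.1 * (m * l.2) / q * ∑ i, (cellMean y i - ξ.2) ^ 2 := by
      rw [v₁, v₂, Finset.mul_sum, Finset.mul_sum, Finset.mul_sum, Finset.mul_sum,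
        ← Finset.sum_add_distrib, ← Finset.sum_add_distrib]
      refine Finset.sum_congr rfl fun i _ => ?_
      rw [← hθ i]
      ring
    have hμ := sum_sq_sub_eq (n := K) (by omega) (cellMean y) ξ.2
    have hmu : s₀ * (ξ.2 - h.m₀) ^ 2 + t * (ξ.2 - grandMean y) ^ 2 =
        (s₀ + t) * (ξ.2 - muMean y h s₀ l) ^ 2 +
          s₀ * t / (s₀ + t) * (grandMean y - h.m₀) ^ 2 := by
      have : muMean y h s₀ l = (s₀ * h.m₀ + t * grandMean y) / (s₀ + t) := rfl
      rw [this]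
      have hp' : s₀ + t ≠ 0 := hp.ne'
      field_simp
      ring
    have hμ' : l.1 * (m * l.2) / q * ∑ i, (cellMean y i - ξ.2) ^ 2 =
        l.1 * (m * l.2) / q * ∑ i, (cellMean y i - grandMean y) ^ 2 +
          t * (ξ.2 - grandMean y) ^ 2 := by
      rw [hμ, htq]
      have : grandMean y = (∑ i, cellMean y i) / K := rfl
      rw [← this]
      ring
    rw [hD]
    linarith
  set A : ℝ := gaussNorm (m * K) * gaussNorm K * Real.sqrt (s₀ / (2 * Real.pi)) *
    (l.1 ^ ((K : ℝ) / 2) * gammaPDFReal h.a₁ h.b₁ l.1) *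
    (l.2 ^ (total K m / 2) * gammaPDFReal h.a₂ h.b₂ l.2) with hA
  set B : ℝ := Real.sqrt ((s₀ + t) / (2 * Real.pi)) * Real.sqrt (q / (2 * Real.pi)) ^ K with hB
  have hApos : 0 < A := by
    have := gaussNorm_pos (m * K)
    have := gaussNorm_pos K
    have := gammaPDFReal_pos ha1 hb1 h1
    have := gammaPDFReal_pos ha2 hb2 h2
    positivity
  have hBpos : 0 < B := by positivity
  refine ⟨A / B * Real.exp (-(D / 2)), by positivity, fun ξ => ?_⟩
  rw [jointDensityReal_eq (by omega) y h s₀ h1 h2, gaussianPDFReal_toNNReal_inv hs, locDensity,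
    hierDensity_eq hp hq, ← hB]
  have hexp : Real.exp (-(s₀ * (ξ.2 - h.m₀) ^ 2 / 2)) * Real.exp (-(v₁ ξ / 2 * l.1)) *
      Real.exp (-((SSE y + v₂ y ξ.1) / 2 * l.2)) = Real.exp (-(D / 2)) *
        Real.exp (-(((s₀ + t) * (ξ.2 - muMean y h s₀ l) ^ 2 +
          q * ∑ i, (ξ.1 i - thetaMean y l ξ.2 i) ^ 2) / 2)) := by
    rw [← Real.exp_add, ← Real.exp_add, ← Real.exp_add]
    congr 1
    linarith [hquad ξ]
  calc _ = A * (Real.exp (-(s₀ * (ξ.2 - h.m₀) ^ 2 / 2)) * Real.exp (-(v₁ ξ / 2 * l.1)) *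
      Real.exp (-((SSE y + v₂ y ξ.1) / 2 * l.2))) := by rw [hA]; ring
    _ = _ := by
      rw [hexp]
      field_simp

/-! ### Conditional densities, posterior and invariance -/

lemma one_lt_shapes (hK : 3 ≤ K) (hm : 2 ≤ m) {h : Prior} (hh : h.Proper) :
    1 < (K : ℝ) / 2 + h.a₁ ∧ 1 < total K m / 2 + h.a₂ := by
  have hK' : (3 : ℝ) ≤ K := by exact_mod_cast hK
  have hm' : (2 : ℝ) ≤ m := by exact_mod_cast hm
  have hM : 6 ≤ total K m := by unfold total; nlinarith
  exact ⟨by linarith [hh.1], by linarith [hh.2.2.1]⟩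

lemma v₁_nonneg (ξ : Loc K) : 0 ≤ v₁ ξ := by unfold v₁; positivity

lemma v₂_nonneg (y : Fin K → Fin m → ℝ) (θ : Fin K → ℝ) : 0 ≤ v₂ y θ := by unfold v₂; positivity

lemma SSE_nonneg (y : Fin K → Fin m → ℝ) : 0 ≤ SSE y := by unfold SSE; positivity

lemma rates_pos (y : Fin K → Fin m → ℝ) {h : Prior} (hh : h.Proper) (ξ : Loc K) :
    0 < v₁ ξ / 2 + h.b₁ ∧ 0 < (SSE y + v₂ y ξ.1) / 2 + h.b₂ := by
  have := v₁_nonneg ξ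
  have := v₂_nonneg y ξ.1
  have := SSE_nonneg y
  exact ⟨by linarith [hh.2.1], by linarith [hh.2.2.2]⟩

lemma precDensity_eq_zero (hK : 3 ≤ K) (hm : 2 ≤ m) (y : Fin K → Fin m → ℝ) {h : Prior}
    (hh : h.Proper) (ξ : Loc K) {l : Prec} (hl : ¬(0 < l.1 ∧ 0 < l.2)) :
    precDensity y h ξ l = 0 := by
  obtain ⟨h1, h2⟩ := one_lt_shapes hK hm hh
  rw [precDensity]
  by_cases hl1 : 0 < l.1
  · rw [gammaPDFReal_of_nonpos (x := l.2) h2 (not_lt.1 fun hl2 => hl ⟨hl1, hl2⟩), mul_zero]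
  · rw [gammaPDFReal_of_nonpos h1 (not_lt.1 hl1), zero_mul]

lemma lintegral_precDensity (hK : 3 ≤ K) (hm : 2 ≤ m) (y : Fin K → Fin m → ℝ) {h : Prior}
    (hh : h.Proper) (ξ : Loc K) : ∫⁻ l, ENNReal.ofReal (precDensity y h ξ l) = 1 := by
  obtain ⟨h1, h2⟩ := one_lt_shapes hK hm hh
  obtain ⟨r1, r2⟩ := rates_pos y hh ξ
  have : ∀ l : Prec, ENNReal.ofReal (precDensity y h ξ l) =
      gammaPDF (K / 2 + h.a₁) (v₁ ξ / 2 + h.b₁) l.1 *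
        gammaPDF (total K m / 2 + h.a₂) ((SSE y + v₂ y ξ.1) / 2 + h.b₂) l.2 := fun l =>
    ENNReal.ofReal_mul (gammaPDFReal_nonneg (by linarith) r1 _)
  simp_rw [this]
  rw [Measure.volume_eq_prod, lintegral_prod_mul
    (measurable_gammaPDF _ _).aemeasurable
    (measurable_gammaPDF _ _).aemeasurable,
    lintegral_gammaPDF_eq_one (by linarith) r1, lintegral_gammaPDF_eq_one (by linarith) r2, one_mul]

lemma ofReal_const_mul_div_lintegral {S : Type*} [MeasurableSpace S] {μ : Measure S}
    {C : ℝ} (hC : 0 < C) {J g : S → ℝ} (hJ : ∀ s, J s = C * g s)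
    (hg : ∫⁻ s, ENNReal.ofReal (g s) ∂μ = 1) :
    ∫⁻ s, ENNReal.ofReal (J s) ∂μ = ENNReal.ofReal C ∧ ∀ s,
      ENNReal.ofReal (J s) / ∫⁻ s, ENNReal.ofReal (J s) ∂μ = ENNReal.ofReal (g s) := by
  have h1 : ∀ s, ENNReal.ofReal (J s) = ENNReal.ofReal C * ENNReal.ofReal (g s) := fun s => by
    rw [hJ, ENNReal.ofReal_mul hC.le]
  have h2 : ∫⁻ s, ENNReal.ofReal (J s) ∂μ = ENNReal.ofReal C := by
    simp_rw [h1]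
    rw [lintegral_const_mul' _ _ ENNReal.ofReal_ne_top, hg, mul_one]
  refine ⟨h2, fun s => ?_⟩
  rw [h2, h1, mul_comm]
  exact ENNReal.mul_div_cancel_right (ENNReal.ofReal_pos.2 hC).ne' ENNReal.ofReal_ne_top

lemma measurable_condLoc (y : Fin K → Fin m → ℝ) (h : Prior) (s₀ : ℝ) :
    Measurable fun x : State K => condLoc y h s₀ x.2 x.1 := by
  have hJ := measurable_jointDensity y h s₀
  have h2 : Measurable (fun l : Prec => ∫⁻ ξ' : Loc K, jointDensity y h s₀ l ξ') :=
    Measurable.lintegral_prod_right' (f := fun x : State K => jointDensity y h s₀ x.1 x.2) hJ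
  exact hJ.div (h2.comp measurable_fst)

lemma lintegral_locDensity (hK : 3 ≤ K) (hm : 2 ≤ m) (y : Fin K → Fin m → ℝ) (h : Prior)
    {s₀ : ℝ} (hs : 0 < s₀) {l : Prec} (h1 : 0 < l.1) (h2 : 0 < l.2) :
    ∫⁻ ξ, ENNReal.ofReal (locDensity y h s₀ l ξ) = 1 := by
  have hm0 : (0 : ℝ) < m := by exact_mod_cast (show 0 < m by omega)
  have ht := flatPrec_pos (K := K) (m := m) (by omega) (by omega) h1 h2
  exact lintegral_hierDensity (by positivity) (by positivity) (measurable_thetaMean y l)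

section Model

variable (hK : 3 ≤ K) (hm : 2 ≤ m) (y : Fin K → Fin m → ℝ) {h : Prior} (hh : h.Proper)
  {s₀ : ℝ} (hs : 0 < s₀)
include hK hm hh hs

/-- Since the normalising constant is positive and finite, `condPrec` is the honest conditional
density of `λ` given `ξ`, a product of Gamma densities. -/
lemma lintegral_jointDensity_prec (ξ : Loc K) :
    (∫⁻ l, jointDensity y h s₀ l ξ ≠ 0 ∧ ∫⁻ l, jointDensity y h s₀ l ξ ≠ ∞) ∧
      ∀ l, condPrec y h s₀ l ξ = ENNReal.ofReal (precDensity y h ξ l) := by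
  obtain ⟨C, hC, hJ⟩ := exists_jointDensityReal_eq_precDensity hK hm y hh hs ξ
  obtain ⟨h1, h2⟩ := ofReal_const_mul_div_lintegral hC hJ (lintegral_precDensity hK hm y hh ξ)
  have h1' : ∫⁻ l, jointDensity y h s₀ l ξ = ENNReal.ofReal C := h1
  rw [h1']
  exact ⟨⟨(ENNReal.ofReal_pos.2 hC).ne', ENNReal.ofReal_ne_top⟩, h2⟩

/-- For positive precisions `condLoc` is the honest conditional density of `ξ` given `λ`, a
hierarchical Gaussian density; for other `λ` the quotient defining it is `0 / 0`. -/
lemma lintegral_jointDensity_loc {l : Prec} (h1 : 0 < l.1) (h2 : 0 < l.2) :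
    (∫⁻ ξ, jointDensity y h s₀ l ξ ≠ 0 ∧ ∫⁻ ξ, jointDensity y h s₀ l ξ ≠ ∞) ∧
      ∀ ξ, condLoc y h s₀ ξ l = ENNReal.ofReal (locDensity y h s₀ l ξ) := by
  obtain ⟨C, hC, hJ⟩ := exists_jointDensityReal_eq_locDensity hK hm y hh hs h1 h2
  obtain ⟨e1, e2⟩ := ofReal_const_mul_div_lintegral hC hJ
    (lintegral_locDensity hK hm y h hs h1 h2)
  have e1' : ∫⁻ ξ, jointDensity y h s₀ l ξ = ENNReal.ofReal C := e1
  rw [e1']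
  exact ⟨⟨(ENNReal.ofReal_pos.2 hC).ne', ENNReal.ofReal_ne_top⟩, e2⟩

lemma lintegral_condLoc {l : Prec} (h1 : 0 < l.1) (h2 : 0 < l.2) :
    ∫⁻ ξ, condLoc y h s₀ ξ l = 1 := by
  simp_rw [(lintegral_jointDensity_loc hK hm y hh hs h1 h2).2]
  exact lintegral_locDensity hK hm y h hs h1 h2

/-- One step of the sampler draws `λ` from its conditional law and then `ξ` given `λ`. -/
lemma lintegral_blockGibbs (x : State K) {f : State K → ℝ≥0∞} (hf : Measurable f) :
    ∫⁻ z, f z ∂(blockGibbs y h s₀ x) =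
      ∫⁻ l, ENNReal.ofReal (precDensity y h x.2 l) * ∫⁻ ξ, condLoc y h s₀ ξ l * f (l, ξ) := by
  have hk : Measurable (blockGibbsMTD y h s₀ x) :=
    (measurable_blockGibbsMTD y h s₀).of_uncurry_left
  have happ : blockGibbs y h s₀ x = volume.withDensity (blockGibbsMTD y h s₀ x) := rfl
  rw [happ, lintegral_withDensity_eq_lintegral_mul _ hk hf, Measure.volume_eq_prod,
    lintegral_prod _ (hk.mul hf).aemeasurable]
  refine lintegral_congr fun l => ?_
  rw [← lintegral_const_mul' _ _ ENNReal.ofReal_ne_top]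
  refine lintegral_congr fun ξ => ?_
  rw [← (lintegral_jointDensity_prec hK hm y hh hs x.2).2 l, ← mul_assoc, Pi.mul_apply,
    blockGibbsMTD]

lemma isMarkovKernel_blockGibbs : IsMarkovKernel (blockGibbs y h s₀) := by
  refine ⟨fun x => ⟨?_⟩⟩
  rw [← lintegral_one, lintegral_blockGibbs hK hm y hh hs x measurable_const]
  refine (lintegral_congr fun l => ?_).trans (lintegral_precDensity hK hm y hh x.2)
  by_cases hl : 0 < l.1 ∧ 0 < l.2
  · rw [lintegral_congr fun ξ => mul_one (condLoc y h s₀ ξ l),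
      lintegral_condLoc hK hm y hh hs hl.1 hl.2, mul_one]
  · rw [precDensity_eq_zero hK hm y hh x.2 hl]
    simp

/-- The posterior normalising constant is positive and finite. It is finite because the likelihood
is at most `(λ_e / 2π) ^ (M / 2)`, which the Gamma prior on `λ_e` integrates. -/
lemma lintegral_jointDensity_ne :
    ∫⁻ z : State K, jointDensity y h s₀ z.1 z.2 ≠ 0 ∧
      ∫⁻ z : State K, jointDensity y h s₀ z.1 z.2 ≠ ∞ := by
  have hJ := measurable_jointDensity y h s₀
  have hh' := hh
  obtain ⟨ha1, hb1, ha2, hb2⟩ := hh'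
  have hM : 0 < total K m / 2 + h.a₂ := by linarith [(one_lt_shapes hK hm hh).2]
  have hM' : 0 < h.a₂ + total K m / 2 := by linarith
  constructor
  · rw [Measure.volume_eq_prod, lintegral_prod_symm' _ hJ]
    intro h0
    have hmeas : Measurable (fun ξ : Loc K => ∫⁻ l' : Prec, jointDensity y h s₀ l' ξ) :=
      Measurable.lintegral_prod_left' (f := fun x : State K => jointDensity y h s₀ x.1 x.2) hJ
    rw [lintegral_eq_zero_iff hmeas] at h0
    obtain ⟨ξ, hξ⟩ := h0.exists
    exact (lintegral_jointDensity_prec hK hm y hh hs ξ).1.1 hξ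
  · rw [Measure.volume_eq_prod, lintegral_prod _ hJ.aemeasurable]
    set c := gaussNorm (m * K) * gammaConj h.a₂ h.b₂ (total K m / 2) 0 with hc
    have hc0 : 0 ≤ c := mul_nonneg (gaussNorm_pos _).le (gammaConj_pos ha2 hM' hb2 le_rfl).le
    have hbound : ∀ l : Prec, ∫⁻ ξ, jointDensity y h s₀ l ξ ≤
        gammaPDF h.a₁ h.b₁ l.1 *
          (ENNReal.ofReal c * gammaPDF (h.a₂ + total K m / 2) h.b₂ l.2) := by
      intro l
      by_cases hl : 0 < l.1 ∧ 0 < l.2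
      · obtain ⟨h1, h2⟩ := hl
        have hprior : ∀ ξ : Loc K, jointDensityReal y h s₀ l ξ ≤
            gammaPDFReal h.a₁ h.b₁ l.1 * (c * gammaPDFReal (h.a₂ + total K m / 2) h.b₂ l.2) *
              hierDensity h.m₀ s₀ l.1 (fun μ _ => μ) ξ := by
          intro ξ
          have hconj := rpow_mul_exp_mul_gammaPDFReal (a := h.a₂) hM' hb2 le_rfl h2
          rw [zero_mul, neg_zero, Real.exp_zero, mul_one, add_zero] at hconj
          have hexp : Real.exp (-((SSE y + v₂ y ξ.1) / 2 * l.2)) ≤ 1 := by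
            have := v₂_nonneg y ξ.1
            have := SSE_nonneg y
            rw [Real.exp_le_one_iff, neg_nonpos]
            positivity
          have hH := hierDensity_nonneg h.m₀ s₀ l.1 (fun μ (_ : Fin K) => μ) ξ
          have hg1 := gammaPDFReal_nonneg ha1 hb1 l.1
          have hg2 := gammaPDFReal_nonneg ha2 hb2 l.2
          have hn := (gaussNorm_pos (m * K)).le
          rw [jointDensityReal_eq (by omega) y h s₀ h1 h2]
          calc _ = gammaPDFReal h.a₁ h.b₁ l.1 * (gaussNorm (m * K) *
                (l.2 ^ (total K m / 2) * gammaPDFReal h.a₂ h.b₂ l.2 *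
                  Real.exp (-((SSE y + v₂ y ξ.1) / 2 * l.2)))) *
                hierDensity h.m₀ s₀ l.1 (fun μ _ => μ) ξ := by
                rw [hierDensity, prod_gaussianPDFReal_theta h1]; ring
            _ ≤ gammaPDFReal h.a₁ h.b₁ l.1 * (gaussNorm (m * K) *
                (l.2 ^ (total K m / 2) * gammaPDFReal h.a₂ h.b₂ l.2 * 1)) *
                hierDensity h.m₀ s₀ l.1 (fun μ _ => μ) ξ := by gcongr
            _ = _ := by rw [mul_one, hconj, hc]; ring
        have hg1 := gammaPDFReal_nonneg ha1 hb1 l.1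
        have hg2 := gammaPDFReal_nonneg hM' hb2 l.2
        calc ∫⁻ ξ, jointDensity y h s₀ l ξ ≤ ∫⁻ ξ, ENNReal.ofReal
              (gammaPDFReal h.a₁ h.b₁ l.1 * (c * gammaPDFReal (h.a₂ + total K m / 2) h.b₂ l.2)) *
              ENNReal.ofReal (hierDensity h.m₀ s₀ l.1 (fun μ _ => μ) ξ) := by
              refine lintegral_mono fun ξ => ?_
              rw [← ENNReal.ofReal_mul (by positivity)]
              exact ENNReal.ofReal_le_ofReal (hprior ξ)
          _ = ENNReal.ofReal (gammaPDFReal h.a₁ h.b₁ l.1 *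
              (c * gammaPDFReal (h.a₂ + total K m / 2) h.b₂ l.2)) := by
              rw [lintegral_const_mul' _ _ ENNReal.ofReal_ne_top,
                lintegral_hierDensity (w := fun μ _ => μ) hs h1
                  (measurable_pi_lambda _ fun _ => measurable_id), mul_one]
          _ = _ := by rw [ENNReal.ofReal_mul hg1, ENNReal.ofReal_mul hc0]; rfl
      · have : ∀ ξ, jointDensity y h s₀ l ξ = 0 := fun ξ => by
          rw [jointDensity, jointDensityReal_eq_zero (by omega) (by omega) y h s₀ hl]; simp
        simp_rw [this]
        simp
    refine ne_top_of_le_ne_top ?_ (lintegral_mono hbound)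
    rw [Measure.volume_eq_prod, lintegral_prod_mul
      (measurable_gammaPDF _ _).aemeasurable
      ((measurable_gammaPDF _ _).const_mul _).aemeasurable,
      lintegral_const_mul' _ _ ENNReal.ofReal_ne_top, lintegral_gammaPDF_eq_one ha1 hb1,
      lintegral_gammaPDF_eq_one hM' hb2]
    simp

lemma isProbabilityMeasure_posterior : IsProbabilityMeasure (posterior y h s₀) := by
  obtain ⟨h0, ht⟩ := lintegral_jointDensity_ne hK hm y hh hs
  refine ⟨?_⟩
  rw [posterior, withDensity_apply _ MeasurableSet.univ, Measure.restrict_univ]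
  simp_rw [posteriorDensity, div_eq_mul_inv]
  rw [lintegral_mul_const' _ _ (ENNReal.inv_ne_top.2 h0), ENNReal.mul_inv_cancel h0 ht]

/-- The block Gibbs sampler leaves the posterior invariant: redrawing `λ` from its conditional
law, then `ξ` from its conditional law, preserves the joint law. -/
lemma invariant_posterior : (blockGibbs y h s₀).Invariant (posterior y h s₀) := by
  have hJ := measurable_jointDensity y h s₀
  obtain ⟨h0, ht⟩ := lintegral_jointDensity_ne hK hm y hh hs
  set Z := ∫⁻ z : State K, jointDensity y h s₀ z.1 z.2 with hZ
  have hZi : Z⁻¹ ≠ ∞ := ENNReal.inv_ne_top.2 h0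
  have hpost : ∀ f : State K → ℝ≥0∞, Measurable f →
      ∫⁻ x, f x ∂(posterior y h s₀) = Z⁻¹ * ∫⁻ x : State K, jointDensity y h s₀ x.1 x.2 * f x := by
    intro f hf
    have hd : Measurable (posteriorDensity y h s₀) := hJ.div measurable_const
    rw [posterior, lintegral_withDensity_eq_lintegral_mul _ hd hf, ← lintegral_const_mul' _ _ hZi]
    refine lintegral_congr fun x => ?_
    rw [Pi.mul_apply, posteriorDensity, ← hZ, div_eq_mul_inv]
    ring
  rw [Kernel.Invariant]
  ext A hA
  set f : State K → ℝ≥0∞ := A.indicator 1 with hf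
  have hfm : Measurable f := measurable_one.indicator hA
  have hcl := measurable_condLoc y h s₀
  set H : Prec → ℝ≥0∞ := fun l => ∫⁻ ξ, condLoc y h s₀ ξ l * f (l, ξ) with hH
  have hHm : Measurable H := Measurable.lintegral_prod_right'
    (f := fun x : State K => condLoc y h s₀ x.2 x.1 * f x) (hcl.mul hfm)
  have hstep : ∀ x : State K, blockGibbs y h s₀ x A = ∫⁻ l, condPrec y h s₀ l x.2 * H l := by
    intro x
    rw [← lintegral_indicator_one hA, lintegral_blockGibbs hK hm y hh hs x hfm]
    exact lintegral_congr fun l => by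
      rw [(lintegral_jointDensity_prec hK hm y hh hs x.2).2 l]
  have hfac : ∀ ξ : Loc K, ∫⁻ l', jointDensity y h s₀ l' ξ * ∫⁻ l, condPrec y h s₀ l ξ * H l =
      ∫⁻ l, jointDensity y h s₀ l ξ * H l := by
    intro ξ
    obtain ⟨⟨hc0, hct⟩, -⟩ := lintegral_jointDensity_prec hK hm y hh hs ξ
    have hJξ : Measurable fun l => jointDensity y h s₀ l ξ :=
      hJ.comp (f := fun l : Prec => ((l, ξ) : State K)) measurable_prodMk_right
    rw [lintegral_mul_const _ hJξ, ← lintegral_const_mul' _ _ hct]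
    refine lintegral_congr fun l => ?_
    rw [condPrec, ← mul_assoc, ENNReal.mul_div_cancel hc0 hct]
  have hfac2 : ∀ l, ∫⁻ ξ, jointDensity y h s₀ l ξ * H l =
      ∫⁻ ξ, jointDensity y h s₀ l ξ * f (l, ξ) := by
    intro l
    by_cases hl : 0 < l.1 ∧ 0 < l.2
    · obtain ⟨⟨hc0, hct⟩, -⟩ := lintegral_jointDensity_loc hK hm y hh hs hl.1 hl.2
      have hJl : Measurable fun ξ => jointDensity y h s₀ l ξ :=
        hJ.comp (f := fun ξ : Loc K => ((l, ξ) : State K)) measurable_prodMk_left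
      rw [lintegral_mul_const _ hJl, hH, ← lintegral_const_mul' _ _ hct]
      refine lintegral_congr fun ξ => ?_
      rw [condLoc, ← mul_assoc, ENNReal.mul_div_cancel hc0 hct]
    · have : ∀ ξ, jointDensity y h s₀ l ξ = 0 := fun ξ => by
        rw [jointDensity, jointDensityReal_eq_zero (by omega) (by omega) y h s₀ hl]; simp
      simp_rw [this, zero_mul]
  have hJH : Measurable fun x : State K => jointDensity y h s₀ x.1 x.2 * H x.1 :=
    hJ.mul (hHm.comp measurable_fst)
  rw [Measure.bind_apply hA (blockGibbs y h s₀).aemeasurable,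
    hpost _ ((blockGibbs y h s₀).measurable_coe hA), ← lintegral_indicator_one hA, hpost _ hfm]
  congr 1
  have hGm : Measurable fun x : State K => jointDensity y h s₀ x.1 x.2 * blockGibbs y h s₀ x A :=
    hJ.mul ((blockGibbs y h s₀).measurable_coe hA)
  calc ∫⁻ x : State K, jointDensity y h s₀ x.1 x.2 * blockGibbs y h s₀ x A
      = ∫⁻ ξ, ∫⁻ l', jointDensity y h s₀ l' ξ * ∫⁻ l, condPrec y h s₀ l ξ * H l := by
        rw [Measure.volume_eq_prod, lintegral_prod_symm' _ hGm]
        simp_rw [hstep]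
    _ = ∫⁻ ξ, ∫⁻ l, jointDensity y h s₀ l ξ * H l := lintegral_congr hfac
    _ = ∫⁻ l, ∫⁻ ξ, jointDensity y h s₀ l ξ * H l :=
        (lintegral_lintegral_swap (f := fun l ξ => jointDensity y h s₀ l ξ * H l)
          hJH.aemeasurable).symm
    _ = ∫⁻ l, ∫⁻ ξ, jointDensity y h s₀ l ξ * f (l, ξ) := lintegral_congr hfac2
    _ = ∫⁻ x : State K, jointDensity y h s₀ x.1 x.2 * f x := by
        rw [Measure.volume_eq_prod]
        exact (lintegral_prod (fun x : State K => jointDensity y h s₀ x.1 x.2 * f x)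
          (hJ.mul hfm).aemeasurable).symm

end Model

/-! ### The drift function -/

lemma drift_eq_sum (hm : m ≠ 0) (y : Fin K → Fin m → ℝ) (φ : ℝ) (ξ : Loc K) :
    drift y φ ξ = ∑ i, (φ * (ξ.1 i - ξ.2) ^ 2 + (ξ.1 i - cellMean y i) ^ 2) := by
  have hm' : (m : ℝ) ≠ 0 := by exact_mod_cast hm
  rw [drift, v₁, v₂, Finset.mul_sum, Finset.mul_sum, ← Finset.sum_add_distrib]
  refine Finset.sum_congr rfl fun i _ => ?_
  field_simp

lemma drift_nonneg {φ : ℝ} (hφ : 0 ≤ φ) (y : Fin K → Fin m → ℝ) (ξ : Loc K) :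
    0 ≤ drift y φ ξ := by
  have := v₁_nonneg ξ
  have := v₂_nonneg y ξ.1
  unfold drift
  positivity

lemma measurable_drift (y : Fin K → Fin m → ℝ) (φ : ℝ) : Measurable (drift y φ) := by
  unfold drift v₁ v₂
  fun_prop

/-- Completing the square first in each `θ_i`, then in `μ`. -/
lemma drift_eq_completed_squares (hK : K ≠ 0) (hm : m ≠ 0) (y : Fin K → Fin m → ℝ) {φ : ℝ}
    (hφ : 0 < φ) (ξ : Loc K) :
    drift y φ ξ = (1 + φ) * ∑ i, (ξ.1 i - (φ * ξ.2 + cellMean y i) / (1 + φ)) ^ 2 +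
      φ / (1 + φ) * (K * (ξ.2 - grandMean y) ^ 2) +
      φ / (1 + φ) * ∑ i, (cellMean y i - grandMean y) ^ 2 := by
  have hμ := sum_sq_sub_eq hK (cellMean y) ξ.2
  have hg : grandMean y = (∑ i, cellMean y i) / K := rfl
  rw [← hg] at hμ
  have h1 : ∀ i, φ * (ξ.1 i - ξ.2) ^ 2 + (ξ.1 i - cellMean y i) ^ 2 =
      (1 + φ) * (ξ.1 i - (φ * ξ.2 + cellMean y i) / (1 + φ)) ^ 2 +
        φ / (1 + φ) * (cellMean y i - ξ.2) ^ 2 := fun i => by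
    field_simp
    ring
  rw [drift_eq_sum hm]
  simp_rw [h1]
  rw [Finset.sum_add_distrib, ← Finset.mul_sum, ← Finset.mul_sum, hμ]
  ring

lemma drift_xiOpt (hK : K ≠ 0) (hm : m ≠ 0) (y : Fin K → Fin m → ℝ) {φ : ℝ} (hφ : 0 < φ) :
    drift y φ (xiOpt y φ) = φ / (1 + φ) * ∑ i, (cellMean y i - grandMean y) ^ 2 := by
  rw [drift_eq_completed_squares hK hm y hφ, xiOpt]
  simp

lemma drift_xiOpt_lt (hK : K ≠ 0) (hm : m ≠ 0) (y : Fin K → Fin m → ℝ) {φ : ℝ} (hφ : 0 < φ)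
    {ξ : Loc K} (hξ : ξ ≠ xiOpt y φ) : drift y φ (xiOpt y φ) < drift y φ ξ := by
  have hK' : (0 : ℝ) < K := by exact_mod_cast Nat.pos_of_ne_zero hK
  rw [drift_xiOpt hK hm y hφ, drift_eq_completed_squares hK hm y hφ ξ, lt_add_iff_pos_left]
  set S := ∑ i, (ξ.1 i - (φ * ξ.2 + cellMean y i) / (1 + φ)) ^ 2 with hS
  have hS0 : 0 ≤ S := Finset.sum_nonneg fun i _ => sq_nonneg _
  by_cases hμ : ξ.2 = grandMean y
  · have hSpos : 0 < S := by
      refine lt_of_le_of_ne hS0 fun h0 => hξ ?_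
      have hz := (Finset.sum_eq_zero_iff_of_nonneg fun i _ => sq_nonneg _).1 (hS ▸ h0.symm)
      refine Prod.ext (funext fun i => ?_) hμ
      have := sq_eq_zero_iff.1 (hz i (Finset.mem_univ i))
      rw [hμ] at this
      exact sub_eq_zero.1 this
    positivity
  · have : 0 < (ξ.2 - grandMean y) ^ 2 := by
      have := sub_ne_zero.2 hμ
      positivity
    positivity

lemma driftConst_nonneg (hK : 3 ≤ K) (hm : 2 ≤ m) (y : Fin K → Fin m → ℝ) {h : Prior}
    (hh : h.Proper) {φ : ℝ} (hφ : 0 < φ) : 0 ≤ driftConst y h φ := by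
  obtain ⟨h1, h2⟩ := one_lt_shapes hK hm hh
  obtain ⟨-, hb1, -, hb2⟩ := hh
  have := SSE_nonneg y
  have hd1 : 0 < 2 * h.a₁ + K - 2 := by linarith
  have hd2 : 0 < 2 * h.a₂ + total K m - 2 := by linarith
  have : 0 ≤ ∑ i, max ((grandMean y - cellMean y i) ^ 2) ((h.m₀ - cellMean y i) ^ 2) :=
    Finset.sum_nonneg fun i _ => (sq_nonneg _).trans (le_max_left _ _)
  have : 0 ≤ max φ 1 := hφ.le.trans (le_max_left _ _)
  unfold driftConst c₁ c₂ δ₁ δ₂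
  positivity

/-- The bound on `E(V | λ)`: the mean of `V` under the conditional law of `ξ` given `λ`, in which
the prior precision `s₀` of `μ` has been dropped. -/
lemma sum_mean_drift_le (hK : 3 ≤ K) (hm : 2 ≤ m) (y : Fin K → Fin m → ℝ) (h : Prior)
    {s₀ : ℝ} (hs : 0 < s₀) {φ : ℝ} (hφ : 0 < φ) {l : Prec} (h1 : 0 < l.1) (h2 : 0 < l.2) :
    ∑ i, ((φ + 1) * (l.1 + m * l.2)⁻¹ +
        (φ * (m * l.2 / (l.1 + m * l.2)) ^ 2 + (l.1 / (l.1 + m * l.2)) ^ 2) *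
          ((s₀ + flatPrec K m l)⁻¹ + (muMean y h s₀ l - cellMean y i) ^ 2)) ≤
      φ * l.1⁻¹ + (φ * K + K + 1) / m * l.2⁻¹ + max φ 1 *
        ∑ i, max ((grandMean y - cellMean y i) ^ 2) ((h.m₀ - cellMean y i) ^ 2) := by
  have hm0 : (0 : ℝ) < m := by exact_mod_cast (show 0 < m by omega)
  have hK0 : (0 : ℝ) < K := by exact_mod_cast (show 0 < K by omega)
  have ht := flatPrec_pos (K := K) (m := m) (by omega) (by omega) h1 h2
  set t := flatPrec K m l with htdef
  have htE : t = K * (l.1 * (m * l.2) / (l.1 + m * l.2)) := rfl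
  set a := l.1
  have hE : (φ * K + K + 1) / m * l.2⁻¹ = (φ * K + K + 1) / (m * l.2) := by field_simp
  rw [hE]
  set E := m * l.2
  have hE0 : 0 < E := by positivity
  set q := a + E with hq
  have hq0 : 0 < q := by positivity
  set κ := φ * (E / q) ^ 2 + (a / q) ^ 2 with hκ
  have hκ0 : 0 ≤ κ := by positivity
  have hmax : 0 ≤ max φ 1 := hφ.le.trans (le_max_left _ _)
  have hκ1 : κ ≤ max φ 1 := by
    have hsum : E / q + a / q = 1 := by rw [← add_div, add_comm E a, ← hq, div_self hq0.ne']
    have e0 : 0 ≤ E / q := by positivity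
    have a0 : 0 ≤ a / q := by positivity
    have e1 : (E / q) ^ 2 + (a / q) ^ 2 ≤ 1 := by nlinarith
    calc κ ≤ max φ 1 * (E / q) ^ 2 + max φ 1 * (a / q) ^ 2 :=
          add_le_add (mul_le_mul_of_nonneg_right (le_max_left _ _) (sq_nonneg _))
            (le_mul_of_one_le_left (sq_nonneg _) (le_max_right _ _))
      _ = max φ 1 * ((E / q) ^ 2 + (a / q) ^ 2) := by ring
      _ ≤ max φ 1 := mul_le_of_le_one_right hmax e1
  have hmean : ∀ i, (muMean y h s₀ l - cellMean y i) ^ 2 ≤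
      max ((grandMean y - cellMean y i) ^ 2) ((h.m₀ - cellMean y i) ^ 2) := by
    -- `muMean` is a convex combination of `m₀` and `ȳ`.
    intro i
    have hst : 0 < s₀ + t := by positivity
    have hmu : muMean y h s₀ l = (s₀ * h.m₀ + t * grandMean y) / (s₀ + t) := rfl
    set X := grandMean y - cellMean y i
    set Y := h.m₀ - cellMean y i
    have hXY : muMean y h s₀ l - cellMean y i = (s₀ * Y + t * X) / (s₀ + t) := by
      rw [hmu]
      field_simp
      ring
    have hX := le_max_left (X ^ 2) (Y ^ 2)
    have hY := le_max_right (X ^ 2) (Y ^ 2)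
    set Mx := max (X ^ 2) (Y ^ 2)
    rw [hXY, div_pow, div_le_iff₀ (by positivity)]
    have k1 : s₀ * (s₀ + t) * Y ^ 2 ≤ s₀ * (s₀ + t) * Mx := by gcongr
    have k2 : t * (s₀ + t) * X ^ 2 ≤ t * (s₀ + t) * Mx := by gcongr
    have k3 : 0 ≤ s₀ * t * (X - Y) ^ 2 := by positivity
    nlinarith
  rw [Finset.sum_add_distrib, Finset.sum_const, ← Finset.mul_sum, Finset.sum_add_distrib,
    Finset.sum_const, Finset.card_univ, Fintype.card_fin, nsmul_eq_mul, nsmul_eq_mul, mul_add]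
  have hA : K * ((φ + 1) * q⁻¹) ≤ (φ * K + K) / E := by
    have : q⁻¹ ≤ E⁻¹ := inv_anti₀ hE0 (by linarith)
    calc K * ((φ + 1) * q⁻¹) ≤ K * ((φ + 1) * E⁻¹) := by gcongr
      _ = _ := by rw [div_eq_mul_inv]; ring
  have hB : κ * (K * (s₀ + t)⁻¹) ≤ φ * a⁻¹ + 1 / E := by
    have k1 : (s₀ + t)⁻¹ ≤ t⁻¹ := inv_anti₀ ht (by linarith)
    have k2 : K * t⁻¹ = q / (a * E) := by rw [htE]; field_simp
    have k3 : E / q ≤ 1 := (div_le_one hq0).2 (by linarith)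
    have k4 : a / q ≤ 1 := (div_le_one hq0).2 (by linarith)
    calc κ * (K * (s₀ + t)⁻¹) ≤ κ * (K * t⁻¹) := by gcongr
      _ = φ * a⁻¹ * (E / q) + 1 / E * (a / q) := by rw [k2, hκ]; field_simp
      _ ≤ φ * a⁻¹ * 1 + 1 / E * 1 := by gcongr
      _ = _ := by ring
  have hC : κ * ∑ i, (muMean y h s₀ l - cellMean y i) ^ 2 ≤ max φ 1 *
      ∑ i, max ((grandMean y - cellMean y i) ^ 2) ((h.m₀ - cellMean y i) ^ 2) :=
    mul_le_mul hκ1 (Finset.sum_le_sum fun i _ => hmean i)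
      (Finset.sum_nonneg fun i _ => sq_nonneg _) hmax
  have hsplit : (φ * K + K + 1) / E = (φ * K + K) / E + 1 / E := by rw [add_div _ (1 : ℝ)]
  rw [hsplit]
  linarith

lemma lintegral_condLoc_mul_drift_le (hK : 3 ≤ K) (hm : 2 ≤ m) (y : Fin K → Fin m → ℝ)
    {h : Prior} (hh : h.Proper) {s₀ : ℝ} (hs : 0 < s₀) {φ : ℝ} (hφ : 0 < φ) {l : Prec}
    (h1 : 0 < l.1) (h2 : 0 < l.2) :
    ∫⁻ ξ, condLoc y h s₀ ξ l * ENNReal.ofReal (drift y φ ξ) ≤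
      ENNReal.ofReal (φ * l.1⁻¹ + (φ * K + K + 1) / m * l.2⁻¹ + max φ 1 *
        ∑ i, max ((grandMean y - cellMean y i) ^ 2) ((h.m₀ - cellMean y i) ^ 2)) := by
  have hm0 : (0 : ℝ) < m := by exact_mod_cast (show 0 < m by omega)
  have ht := flatPrec_pos (K := K) (m := m) (by omega) (by omega) h1 h2
  have hp : 0 < s₀ + flatPrec K m l := by positivity
  have hq : 0 < l.1 + m * l.2 := by positivity
  refine le_of_eq_of_le ?_ (ENNReal.ofReal_le_ofReal
    (sum_mean_drift_le hK hm y h hs hφ h1 h2))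
  simp_rw [(lintegral_jointDensity_loc hK hm y hh hs h1 h2).2, locDensity]
  rw [lintegral_hierDensity_mul hp hq (measurable_thetaMean y l)
    (measurable_drift y φ).ennreal_ofReal]
  set q := l.1 + m * l.2 with hqdef
  set κ := φ * (m * l.2 / q) ^ 2 + (l.1 / q) ^ 2 with hκ
  have hκ0 : 0 ≤ κ := by positivity
  have hinner : ∀ μ : ℝ, ∫⁻ θ, ENNReal.ofReal (drift y φ (θ, μ))
      ∂(Measure.pi fun i => gaussianReal (thetaMean y l μ i) (Real.toNNReal q⁻¹)) =
      ∑ i, (ENNReal.ofReal ((φ + 1) * q⁻¹) +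
        ENNReal.ofReal κ * ENNReal.ofReal ((μ - cellMean y i) ^ 2)) := by
    intro μ
    have hpt : ∀ θ : Fin K → ℝ, ENNReal.ofReal (drift y φ (θ, μ)) =
        ∑ i, (ENNReal.ofReal φ * ENNReal.ofReal ((θ i - μ) ^ 2) +
          ENNReal.ofReal ((θ i - cellMean y i) ^ 2)) := fun θ => by
      rw [drift_eq_sum (by omega), ENNReal.ofReal_sum_of_nonneg fun i _ => by positivity]
      refine Finset.sum_congr rfl fun i _ => ?_
      rw [ENNReal.ofReal_add (by positivity) (by positivity), ENNReal.ofReal_mul hφ.le]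
    have hmom : ∀ (i : Fin K) (c : ℝ), ∫⁻ θ : Fin K → ℝ, ENNReal.ofReal ((θ i - c) ^ 2)
        ∂(Measure.pi fun i => gaussianReal (thetaMean y l μ i) (Real.toNNReal q⁻¹)) =
        ENNReal.ofReal (q⁻¹ + (thetaMean y l μ i - c) ^ 2) := fun i c => by
      rw [← lintegral_sq_sub_gaussianReal hq]
      exact (measurePreserving_eval (fun i => gaussianReal (thetaMean y l μ i)
        (Real.toNNReal q⁻¹)) i).lintegral_comp (f := fun x : ℝ => ENNReal.ofReal ((x - c) ^ 2))
          (by fun_prop)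
    simp_rw [hpt]
    rw [lintegral_finsetSum _ fun i _ => by fun_prop]
    refine Finset.sum_congr rfl fun i _ => ?_
    rw [lintegral_add_left (by fun_prop), lintegral_const_mul' _ _ ENNReal.ofReal_ne_top, hmom,
      hmom, ← ENNReal.ofReal_mul hφ.le, ← ENNReal.ofReal_mul hκ0,
      ← ENNReal.ofReal_add (by positivity) (by positivity),
      ← ENNReal.ofReal_add (by positivity) (by positivity)]
    congr 1
    have hth : thetaMean y l μ i = (l.1 * μ + m * l.2 * cellMean y i) / q := rfl
    have e1 : thetaMean y l μ i - μ = m * l.2 / q * (cellMean y i - μ) := by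
      rw [hth]; field_simp; rw [hqdef]; ring
    have e2 : thetaMean y l μ i - cellMean y i = l.1 / q * (μ - cellMean y i) := by
      rw [hth]; field_simp; rw [hqdef]; ring
    rw [e1, e2, hκ]
    ring
  rw [lintegral_congr hinner, lintegral_finsetSum _ fun i _ => by fun_prop,
    ENNReal.ofReal_sum_of_nonneg fun i _ => by positivity]
  refine Finset.sum_congr rfl fun i _ => ?_
  rw [lintegral_add_left measurable_const, lintegral_const_mul' _ _ ENNReal.ofReal_ne_top,
    lintegral_sq_sub_gaussianReal hp, lintegral_const, measure_univ, mul_one,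
    ← ENNReal.ofReal_mul hκ0, ← ENNReal.ofReal_add (by positivity) (by positivity)]

/-- The real inequality behind the drift condition, once `E(1 / λ_θ)` and `E(1 / λ_e)` have been
computed. -/
lemma gibbs_drift_const_le (hK : 3 ≤ K) (hm : 2 ≤ m) (y : Fin K → Fin m → ℝ) {h : Prior}
    (hh : h.Proper) {γ φ : ℝ} (hφ : 0 < φ) (hγ : φ * δ₅ K m h + δ K m h < γ) (ξ : Loc K) :
    φ * ((v₁ ξ / 2 + h.b₁) / (K / 2 + h.a₁ - 1)) + (φ * K + K + 1) / m *
        (((SSE y + v₂ y ξ.1) / 2 + h.b₂) / (total K m / 2 + h.a₂ - 1)) +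
      max φ 1 * ∑ i, max ((grandMean y - cellMean y i) ^ 2) ((h.m₀ - cellMean y i) ^ 2) ≤
      γ * drift y φ ξ + driftConst y h φ := by
  have hm0 : (0 : ℝ) < m := by exact_mod_cast (show 0 < m by omega)
  obtain ⟨h1, h2⟩ := one_lt_shapes hK hm hh
  have hd1 : 0 < 2 * h.a₁ + K - 2 := by linarith
  have hd2 : 0 < 2 * h.a₂ + total K m - 2 := by linarith
  have hv1 := v₁_nonneg ξ
  have hv2 := v₂_nonneg y ξ.1
  have e1 : (v₁ ξ / 2 + h.b₁) / (K / 2 + h.a₁ - 1) = δ₁ K h * v₁ ξ + c₁ K h := by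
    rw [c₁, δ₁, show (K : ℝ) / 2 + h.a₁ - 1 = (2 * h.a₁ + K - 2) / 2 by ring]
    field_simp
  have e2 : ((SSE y + v₂ y ξ.1) / 2 + h.b₂) / (total K m / 2 + h.a₂ - 1) =
      δ₂ K m h * v₂ y ξ.1 + c₂ y h := by
    rw [c₂, δ₂, show total K m / 2 + h.a₂ - 1 = (2 * h.a₂ + total K m - 2) / 2 by ring]
    field_simp
    ring
  rw [e1, e2, driftConst, drift]
  have hδ1 : δ₁ K h ≤ δ K m h := le_max_left _ _
  have hδ3 : δ₃ K m h ≤ δ K m h := le_max_right _ _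
  have hδ5 : 0 ≤ δ₅ K m h := by unfold δ₅ δ₂; positivity
  have hA : δ₁ K h ≤ γ := by nlinarith [mul_nonneg hφ.le hδ5]
  have hB : φ * δ₅ K m h + δ₃ K m h ≤ γ := by linarith
  have kA : δ₁ K h * (φ * v₁ ξ) ≤ γ * (φ * v₁ ξ) := by gcongr
  have kB : (φ * δ₅ K m h + δ₃ K m h) * ((m : ℝ)⁻¹ * v₂ y ξ.1) ≤ γ * ((m : ℝ)⁻¹ * v₂ y ξ.1) := by
    gcongr
  have kC : (φ * K + K + 1) / m * (δ₂ K m h * v₂ y ξ.1) =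
      (φ * δ₅ K m h + δ₃ K m h) * ((m : ℝ)⁻¹ * v₂ y ξ.1) := by
    rw [δ₅, δ₃]
    field_simp
    ring
  linarith

lemma lintegral_blockGibbs_drift_le (hK : 3 ≤ K) (hm : 2 ≤ m) (y : Fin K → Fin m → ℝ) {h : Prior}
    (hh : h.Proper) {s₀ : ℝ} (hs : 0 < s₀) {γ φ : ℝ} (hφ : 0 < φ)
    (hγ : φ * δ₅ K m h + δ K m h < γ) (x : State K) :
    ∫⁻ z, ENNReal.ofReal (drift y φ z.2) ∂(blockGibbs y h s₀ x) ≤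
      ENNReal.ofReal (γ * drift y φ x.2 + driftConst y h φ) := by
  obtain ⟨h1, h2⟩ := one_lt_shapes hK hm hh
  obtain ⟨r1, r2⟩ := rates_pos y hh x.2
  have hdm : Measurable fun z : State K => ENNReal.ofReal (drift y φ z.2) :=
    ((measurable_drift y φ).comp measurable_snd).ennreal_ofReal
  rw [lintegral_blockGibbs hK hm y hh hs x hdm]
  refine le_trans ?_ (ENNReal.ofReal_le_ofReal (gibbs_drift_const_le hK hm y hh hφ hγ x.2))
  set D := max φ 1 * ∑ i, max ((grandMean y - cellMean y i) ^ 2) ((h.m₀ - cellMean y i) ^ 2)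
    with hD
  have hD0 : 0 ≤ D := mul_nonneg (hφ.le.trans (le_max_left _ _))
    (Finset.sum_nonneg fun i _ => (sq_nonneg _).trans (le_max_left _ _))
  set C := (φ * K + K + 1) / m with hC
  have hC0 : 0 ≤ C := by positivity
  set α₁ := (K : ℝ) / 2 + h.a₁
  set α₂ := total K m / 2 + h.a₂
  set ρ₁ := v₁ x.2 / 2 + h.b₁
  set ρ₂ := (SSE y + v₂ y x.2.1) / 2 + h.b₂
  have hα1 : 0 < α₁ := by linarith
  have hα2 : 0 < α₂ := by linarith
  have hbound : ∀ l : Prec, ENNReal.ofReal (precDensity y h x.2 l) *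
      ∫⁻ ξ, condLoc y h s₀ ξ l * ENNReal.ofReal (drift y φ ξ) ≤
      ENNReal.ofReal φ * ((gammaPDF α₁ ρ₁ l.1 * ENNReal.ofReal (l.1)⁻¹) * gammaPDF α₂ ρ₂ l.2) +
      ENNReal.ofReal C * (gammaPDF α₁ ρ₁ l.1 * (gammaPDF α₂ ρ₂ l.2 * ENNReal.ofReal (l.2)⁻¹)) +
      ENNReal.ofReal D * (gammaPDF α₁ ρ₁ l.1 * gammaPDF α₂ ρ₂ l.2) := by
    intro l
    by_cases hl : 0 < l.1 ∧ 0 < l.2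
    · have i1 : 0 < (l.1)⁻¹ := inv_pos.2 hl.1
      have i2 : 0 < (l.2)⁻¹ := inv_pos.2 hl.2
      refine (mul_le_mul_right
        (lintegral_condLoc_mul_drift_le hK hm y hh hs hφ hl.1 hl.2) _).trans ?_
      rw [← hC, ← hD, precDensity, ENNReal.ofReal_mul (gammaPDFReal_nonneg hα1 r1 _),
        ENNReal.ofReal_add (by positivity) hD0, ENNReal.ofReal_add (by positivity) (by positivity),
        ENNReal.ofReal_mul hφ.le, ENNReal.ofReal_mul hC0]
      refine le_of_eq ?_
      simp only [gammaPDF]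
      ring
    · rw [precDensity_eq_zero hK hm y hh x.2 hl]
      simp
  have hg1 : Measurable (gammaPDF α₁ ρ₁) := measurable_gammaPDF _ _
  have hg2 : Measurable (gammaPDF α₂ ρ₂) := measurable_gammaPDF _ _
  have hi : Measurable fun x : ℝ => ENNReal.ofReal x⁻¹ := by fun_prop
  have I1 : ∫⁻ t, gammaPDF α₁ ρ₁ t * ENNReal.ofReal t⁻¹ = ENNReal.ofReal (ρ₁ / (α₁ - 1)) :=
    lintegral_gammaPDFReal_mul_inv h1 r1
  have I2 : ∫⁻ t, gammaPDF α₂ ρ₂ t * ENNReal.ofReal t⁻¹ = ENNReal.ofReal (ρ₂ / (α₂ - 1)) :=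
    lintegral_gammaPDFReal_mul_inv h2 r2
  have m1 : Measurable fun l : Prec =>
      (gammaPDF α₁ ρ₁ l.1 * ENNReal.ofReal (l.1)⁻¹) * gammaPDF α₂ ρ₂ l.2 :=
    ((hg1.mul hi).comp measurable_fst).mul (hg2.comp measurable_snd)
  have m2 : Measurable fun l : Prec =>
      gammaPDF α₁ ρ₁ l.1 * (gammaPDF α₂ ρ₂ l.2 * ENNReal.ofReal (l.2)⁻¹) :=
    (hg1.comp measurable_fst).mul ((hg2.mul hi).comp measurable_snd)
  have m12 : Measurable fun l : Prec =>
      ENNReal.ofReal φ * ((gammaPDF α₁ ρ₁ l.1 * ENNReal.ofReal (l.1)⁻¹) * gammaPDF α₂ ρ₂ l.2) +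
      ENNReal.ofReal C * (gammaPDF α₁ ρ₁ l.1 * (gammaPDF α₂ ρ₂ l.2 * ENNReal.ofReal (l.2)⁻¹)) :=
    (m1.const_mul _).add (m2.const_mul _)
  have q1 : 0 ≤ ρ₁ / (α₁ - 1) := div_nonneg r1.le (by linarith)
  have q2 : 0 ≤ ρ₂ / (α₂ - 1) := div_nonneg r2.le (by linarith)
  refine (lintegral_mono hbound).trans (le_of_eq ?_)
  rw [lintegral_add_left m12,
    lintegral_add_left (m1.const_mul _), lintegral_const_mul' _ _ ENNReal.ofReal_ne_top,
    lintegral_const_mul' _ _ ENNReal.ofReal_ne_top, lintegral_const_mul' _ _ ENNReal.ofReal_ne_top,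
    Measure.volume_eq_prod,
    lintegral_prod_mul (f := fun t => gammaPDF α₁ ρ₁ t * ENNReal.ofReal t⁻¹)
      (hg1.mul hi).aemeasurable hg2.aemeasurable,
    lintegral_prod_mul (g := fun t => gammaPDF α₂ ρ₂ t * ENNReal.ofReal t⁻¹)
      hg1.aemeasurable (hg2.mul hi).aemeasurable,
    lintegral_prod_mul hg1.aemeasurable hg2.aemeasurable, I1, I2,
    lintegral_gammaPDF_eq_one hα1 r1, lintegral_gammaPDF_eq_one hα2 r2, mul_one, one_mul, mul_one,
    mul_one, ← ENNReal.ofReal_mul hφ.le, ← ENNReal.ofReal_mul hC0,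
    ← ENNReal.ofReal_add (by positivity) (by positivity),
    ← ENNReal.ofReal_add (by positivity) hD0]

/-- The block Gibbs sampler satisfies the drift condition for `V₂`, with constants free of `s₀`. -/
lemma drift_blockGibbs (hK : 3 ≤ K) (hm : 2 ≤ m) (y : Fin K → Fin m → ℝ) {h : Prior}
    (hh : h.Proper) {s₀ : ℝ} (hs : 0 < s₀) {γ φ : ℝ} (hφ : 0 < φ) (hγ0 : 0 ≤ γ)
    (hγ : φ * δ₅ K m h + δ K m h < γ) :
    DriftMinorization.Drift (blockGibbs y h s₀) (fun z => drift y φ z.2) γ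
      (driftConst y h φ) := by
  have hnn : ∀ z : State K, 0 ≤ drift y φ z.2 := fun z => drift_nonneg hφ.le y z.2
  have hmeas : Measurable fun z : State K => drift y φ z.2 :=
    (measurable_drift y φ).comp measurable_snd
  have hint : ∀ x, Integrable (fun z : State K => drift y φ z.2) (blockGibbs y h s₀ x) := fun x =>
    ⟨hmeas.aestronglyMeasurable, by
      rw [hasFiniteIntegral_iff_ofReal (Filter.Eventually.of_forall hnn)]
      exact (lintegral_blockGibbs_drift_le hK hm y hh hs hφ hγ x).trans_lt ENNReal.ofReal_lt_top⟩
  refine ⟨hnn, hmeas, hint, fun x => ?_⟩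
  have hb := driftConst_nonneg hK hm y hh hφ
  refine (ENNReal.ofReal_le_ofReal_iff (add_nonneg (mul_nonneg hγ0 (hnn x)) hb)).1 ?_
  rw [ofReal_integral_eq_lintegral_ofReal (hint x) (Filter.Eventually.of_forall hnn)]
  exact lintegral_blockGibbs_drift_le hK hm y hh hs hφ hγ x

/-! ### Minorization on the sublevel set of the drift function -/

lemma lamThetaStar_eq {h : Prior} (hh : h.Proper) {c : Tuning} (hφ : 0 < c.φ) (hd : 0 < c.dR) :
    lamThetaStar K h c = (K / 2 + h.a₁) *
      (Real.log (c.dR / (2 * c.φ) + h.b₁) - Real.log h.b₁) /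
        (c.dR / (2 * c.φ) + h.b₁ - h.b₁) := by
  obtain ⟨-, hb1, -, -⟩ := hh
  rw [lamThetaStar, ← Real.log_div (by positivity) hb1.ne',
    show (c.dR / (2 * c.φ) + h.b₁) / h.b₁ = 1 + c.dR / (2 * h.b₁ * c.φ) by field_simp; ring,
    add_sub_cancel_right]
  generalize Real.log (1 + c.dR / (2 * h.b₁ * c.φ)) = L
  field_simp

lemma lamErrStar_eq (hm : m ≠ 0) (y : Fin K → Fin m → ℝ) {h : Prior} (hh : h.Proper) {c : Tuning}
    (hd : 0 < c.dR) :
    lamErrStar y h c = (total K m / 2 + h.a₂) *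
      (Real.log ((SSE y + m * c.dR) / 2 + h.b₂) - Real.log (SSE y / 2 + h.b₂)) /
        ((SSE y + m * c.dR) / 2 + h.b₂ - (SSE y / 2 + h.b₂)) := by
  obtain ⟨-, -, -, hb2⟩ := hh
  have hS := SSE_nonneg y
  have hm0 : (0 : ℝ) < m := by exact_mod_cast Nat.pos_of_ne_zero hm
  have hr : 0 < SSE y / 2 + h.b₂ := by positivity
  have hr' : 0 < 2 * h.b₂ + SSE y := by positivity
  rw [lamErrStar, ← Real.log_div (by positivity) hr.ne',
    show ((SSE y + m * c.dR) / 2 + h.b₂) / (SSE y / 2 + h.b₂) =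
      1 + m * c.dR / (2 * h.b₂ + SSE y) by
        rw [show SSE y / 2 + h.b₂ = (2 * h.b₂ + SSE y) / 2 by ring]; field_simp; ring,
    show (SSE y + m * c.dR) / 2 + h.b₂ - (SSE y / 2 + h.b₂) = m * c.dR / 2 by ring]
  field_simp

lemma integral_h₁ (hK : 3 ≤ K) (hm : 2 ≤ m) {h : Prior} (hh : h.Proper) {c : Tuning}
    (hφ : 0 < c.φ) (hd : 0 < c.dR) :
    Measurable (h₁ K h c) ∧ (∀ x, 0 ≤ h₁ K h c x) ∧ Integrable (h₁ K h c) ∧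
      (∫ x in Set.Ioi (0 : ℝ), h₁ K h c x) = ∫ x, h₁ K h c x ∧ 0 < ∫ x, h₁ K h c x ∧
      ∫ x, h₁ K h c x < 1 := by
  have : 0 < c.dR / (2 * c.φ) := by positivity
  exact integral_ite_gammaPDFReal (one_lt_shapes hK hm hh).1 hh.2.1 (by linarith)
    (lamThetaStar_eq hh hφ hd) rfl

lemma integral_h₂ (hK : 3 ≤ K) (hm : 2 ≤ m) (y : Fin K → Fin m → ℝ) {h : Prior} (hh : h.Proper)
    {c : Tuning} (hd : 0 < c.dR) :
    Measurable (h₂ y h c) ∧ (∀ x, 0 ≤ h₂ y h c x) ∧ Integrable (h₂ y h c) ∧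
      (∫ x in Set.Ioi (0 : ℝ), h₂ y h c x) = ∫ x, h₂ y h c x ∧ 0 < ∫ x, h₂ y h c x ∧
      ∫ x, h₂ y h c x < 1 := by
  have hm0 : (0 : ℝ) < m := by exact_mod_cast (show 0 < m by omega)
  have : 0 < m * c.dR := by positivity
  exact integral_ite_gammaPDFReal (one_lt_shapes hK hm hh).2
    (by linarith [SSE_nonneg y, hh.2.2.2]) (by linarith) (lamErrStar_eq (by omega) y hh hd) rfl

lemma epsB_mem_Ioo (hK : 3 ≤ K) (hm : 2 ≤ m) (y : Fin K → Fin m → ℝ) {h : Prior} (hh : h.Proper)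
    {c : Tuning} (hφ : 0 < c.φ) (hd : 0 < c.dR) : 0 < epsB y h c ∧ epsB y h c < 1 := by
  obtain ⟨-, -, -, e1, p1, l1⟩ := integral_h₁ hK hm hh hφ hd
  obtain ⟨-, -, -, e2, p2, l2⟩ := integral_h₂ hK hm y hh hd
  rw [epsB, e1, e2]
  exact ⟨mul_pos p1 p2, mul_lt_one_of_nonneg_of_lt_one_left p1.le l1 l2.le⟩

/-- The common part of all transition laws that start in `{V₂ ≤ d_R}`: the pointwise minimum of the
possible densities of `λ`, followed by the conditional law of `ξ` given `λ`. -/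
noncomputable def minorant (y : Fin K → Fin m → ℝ) (h : Prior) (c : Tuning) (s₀ : ℝ) :
    Measure (State K) :=
  volume.withDensity fun x =>
    ENNReal.ofReal (h₁ K h c x.1.1 * h₂ y h c x.1.2) * condLoc y h s₀ x.2 x.1

lemma minorant_real_univ (hK : 3 ≤ K) (hm : 2 ≤ m) (y : Fin K → Fin m → ℝ) {h : Prior}
    (hh : h.Proper) {s₀ : ℝ} (hs : 0 < s₀) {c : Tuning} (hφ : 0 < c.φ) (hd : 0 < c.dR) :
    (minorant y h c s₀).real Set.univ = epsB y h c := by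
  obtain ⟨m1, n1, i1, e1, p1, -⟩ := integral_h₁ hK hm hh hφ hd
  obtain ⟨m2, n2, i2, e2, p2, -⟩ := integral_h₂ hK hm y hh hd
  obtain ⟨a1, a2⟩ := one_lt_shapes hK hm hh
  have hprod : Measurable fun l : Prec => ENNReal.ofReal (h₁ K h c l.1 * h₂ y h c l.2) :=
    ((m1.comp measurable_fst).mul (m2.comp measurable_snd)).ennreal_ofReal
  have hdens : Measurable fun x : State K =>
      ENNReal.ofReal (h₁ K h c x.1.1 * h₂ y h c x.1.2) * condLoc y h s₀ x.2 x.1 :=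
    (hprod.comp measurable_fst).mul (measurable_condLoc y h s₀)
  have hmass : minorant y h c s₀ Set.univ = ENNReal.ofReal (epsB y h c) := by
    rw [minorant, withDensity_apply _ MeasurableSet.univ, Measure.restrict_univ,
      Measure.volume_eq_prod, lintegral_prod _ hdens.aemeasurable]
    have hin : ∀ l : Prec, ∫⁻ ξ, ENNReal.ofReal (h₁ K h c l.1 * h₂ y h c l.2) *
        condLoc y h s₀ ξ l =
          ENNReal.ofReal (h₁ K h c l.1) * ENNReal.ofReal (h₂ y h c l.2) := by
      intro l
      rw [lintegral_const_mul' _ _ ENNReal.ofReal_ne_top, ← ENNReal.ofReal_mul (n1 _)]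
      by_cases hl : 0 < l.1 ∧ 0 < l.2
      · rw [lintegral_condLoc hK hm y hh hs hl.1 hl.2, mul_one]
      · have : h₁ K h c l.1 * h₂ y h c l.2 = 0 := by
          by_cases hl1 : 0 < l.1
          · have hl2 : l.2 ≤ 0 := not_lt.1 fun hl2 => hl ⟨hl1, hl2⟩
            rw [h₂, gammaPDFReal_of_nonpos a2 hl2, gammaPDFReal_of_nonpos a2 hl2]
            simp
          · rw [h₁, gammaPDFReal_of_nonpos a1 (not_lt.1 hl1),
              gammaPDFReal_of_nonpos a1 (not_lt.1 hl1)]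
            simp
        rw [this]
        simp
    rw [lintegral_congr hin, Measure.volume_eq_prod,
      lintegral_prod_mul m1.ennreal_ofReal.aemeasurable m2.ennreal_ofReal.aemeasurable,
      ← ofReal_integral_eq_lintegral_ofReal i1 (Filter.Eventually.of_forall n1),
      ← ofReal_integral_eq_lintegral_ofReal i2 (Filter.Eventually.of_forall n2),
      ← ENNReal.ofReal_mul p1.le, epsB, e1, e2]
  rw [measureReal_def, hmass, ENNReal.toReal_ofReal (epsB_mem_Ioo hK hm y hh hφ hd).1.le]

lemma minorant_le (hK : 3 ≤ K) (hm : 2 ≤ m) (y : Fin K → Fin m → ℝ) {h : Prior}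
    (hh : h.Proper) {s₀ : ℝ} (hs : 0 < s₀) {c : Tuning} (hφ : 0 < c.φ) (hd : 0 < c.dR)
    {x : State K} (hx : drift y c.φ x.2 ≤ c.dR) : minorant y h c s₀ ≤ blockGibbs y h s₀ x := by
  obtain ⟨-, n1, -⟩ := integral_h₁ hK hm hh hφ hd
  obtain ⟨-, n2, -⟩ := integral_h₂ hK hm y hh hd
  obtain ⟨a1, a2⟩ := one_lt_shapes hK hm hh
  obtain ⟨r1, -⟩ := rates_pos y hh x.2
  have hm0 : (0 : ℝ) < m := by exact_mod_cast (show 0 < m by omega)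
  have hv1 := v₁_nonneg x.2
  have hv2 := v₂_nonneg y x.2.1
  have hS := SSE_nonneg y
  have hb2 := hh.2.2.2
  have hv1' : v₁ x.2 / 2 ≤ c.dR / (2 * c.φ) := by
    have : 0 ≤ (m : ℝ)⁻¹ * v₂ y x.2.1 := by positivity
    have h1 : c.φ * v₁ x.2 ≤ c.dR := by unfold drift at hx; linarith
    rw [div_le_div_iff₀ (by norm_num) (by positivity)]
    linarith
  have hv2' : v₂ y x.2.1 ≤ m * c.dR := by
    have : 0 ≤ c.φ * v₁ x.2 := by positivity
    have h1 : (m : ℝ)⁻¹ * v₂ y x.2.1 ≤ c.dR := by unfold drift at hx; linarith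
    rwa [inv_mul_le_iff₀ hm0] at h1
  have hmd : 0 < m * c.dR := by positivity
  have hdφ : 0 < c.dR / (2 * c.φ) := by positivity
  refine withDensity_mono (Filter.Eventually.of_forall fun z => ?_)
  rw [blockGibbsMTD, (lintegral_jointDensity_prec hK hm y hh hs x.2).2]
  refine mul_le_mul_left (ENNReal.ofReal_le_ofReal ?_) _
  refine mul_le_mul ?_ ?_ (n2 _) (gammaPDFReal_nonneg (by linarith) r1 _)
  · exact ite_gammaPDFReal_le a1 hh.2.1 (by linarith) ⟨by linarith, by linarith⟩
      (lamThetaStar_eq hh hφ hd)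
  · exact ite_gammaPDFReal_le a2 (by linarith) (by linarith) ⟨by linarith, by linarith⟩
      (lamErrStar_eq (by omega) y hh hd)

/-! ### The tuning constants and the limit of the bound -/

lemma delta_pos_and_lt_one (hK : 3 ≤ K) (hm : 2 ≤ m) {h : Prior} (hh : h.Proper) :
    0 < δ K m h ∧ δ K m h < 1 ∧ 0 < δ₅ K m h := by
  have hK' : (3 : ℝ) ≤ K := by exact_mod_cast hK
  have hm' : (2 : ℝ) ≤ m := by exact_mod_cast hm
  have hM : 2 * K ≤ total K m := by unfold total; nlinarith
  obtain ⟨ha1, -, ha2, -⟩ := hh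
  have hd1 : 1 < 2 * h.a₁ + K - 2 := by linarith
  have hd2 : (K : ℝ) + 1 < 2 * h.a₂ + total K m - 2 := by linarith
  have hd2' : 0 < 2 * h.a₂ + total K m - 2 := by linarith
  refine ⟨lt_max_of_lt_left (by unfold δ₁; exact div_pos one_pos (by linarith)), max_lt ?_ ?_, ?_⟩
  · rw [δ₁, div_lt_one (by linarith)]
    exact hd1
  · rw [δ₃, δ₂, mul_one_div, div_lt_one hd2']
    exact hd2
  · unfold δ₅ δ₂
    positivity

lemma exists_admissible (hK : 3 ≤ K) (hm : 2 ≤ m) (y : Fin K → Fin m → ℝ) {h : Prior}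
    (hh : h.Proper) : ∃ c : Tuning, c.Admissible y h := by
  obtain ⟨-, h1, h5⟩ := delta_pos_and_lt_one hK hm hh
  set φ := (1 - δ K m h) / (4 * δ₅ K m h) with hφ
  refine ⟨⟨(1 + δ K m h) / 2, φ,
    2 * driftConst y h φ / (1 - (1 + δ K m h) / 2) + 1⟩, ?_, ?_, ?_, ?_, ?_⟩
  · dsimp only; linarith
  · dsimp only; linarith
  · have : 0 < 1 - δ K m h := by linarith
    dsimp only
    positivity
  · have : φ * δ₅ K m h = (1 - δ K m h) / 4 := by rw [hφ]; field_simp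
    dsimp only
    rw [this]
    linarith
  · dsimp only
    linarith

/-- As `r → 0` the geometric ratio tends to `1 / α < 1`, so a small `r` makes both terms of the
bound decay. -/
lemma exists_tendsto_burnInBound (y : Fin K → Fin m → ℝ) (h : Prior) (c : Tuning)
    (hε0 : 0 < epsB y h c) (hε1 : epsB y h c < 1) (hα : 1 < alpha y h c) (hU : 0 < bigU y h c) :
    ∃ r : ℝ, 0 < r ∧ r < 1 ∧ Filter.Tendsto (burnInBound y h c r) Filter.atTop (nhds 0) := by
  have hα0 : 0 < alpha y h c := by linarith
  set g : ℝ → ℝ := fun r => bigU y h c ^ r / alpha y h c ^ (1 - r) with hg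
  have hcont : ContinuousAt g 0 := by
    refine ContinuousAt.div (Real.continuousAt_const_rpow hU.ne') ?_ (by simp [hα0.ne'])
    exact (Real.continuousAt_const_rpow hα0.ne').comp
      (f := fun r : ℝ => 1 - r) (continuousAt_const.sub continuousAt_id)
  have hg0 : g 0 < 1 := by
    simp only [hg, Real.rpow_zero, sub_zero, Real.rpow_one]
    exact (div_lt_one hα0).2 hα
  have hnear : ∀ᶠ r in nhdsWithin (0 : ℝ) (Set.Ioi 0), g r < 1 ∧ r ∈ Set.Ioo (0 : ℝ) 1 :=
    ((hcont.eventually_lt_const hg0).filter_mono nhdsWithin_le_nhds).and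
      (Ioo_mem_nhdsGT one_pos)
  obtain ⟨r, hr, hr0, hr1⟩ := hnear.exists
  refine ⟨r, hr0, hr1, ?_⟩
  have hgr : 0 ≤ g r := by positivity
  have hβ : 0 < 1 - epsB y h c := by linarith
  have h1 : Filter.Tendsto (fun n : ℕ => (1 - epsB y h c) ^ (r * n)) Filter.atTop (nhds 0) := by
    have : ∀ n : ℕ, (1 - epsB y h c) ^ (r * n) = ((1 - epsB y h c) ^ r) ^ n := fun n => by
      rw [Real.rpow_mul hβ.le, Real.rpow_natCast]
    simp_rw [this]
    exact tendsto_pow_atTop_nhds_zero_of_lt_one (by positivity)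
      (Real.rpow_lt_one hβ.le (by linarith) hr0)
  have h2 := (tendsto_pow_atTop_nhds_zero_of_lt_one hgr hr).mul_const
    (1 + driftConst y h c.φ / (1 - c.γ) +
      c.φ / (1 + c.φ) * ∑ i, (cellMean y i - grandMean y) ^ 2)
  have h3 := h1.add h2
  rw [zero_mul, add_zero] at h3
  exact h3

end RandomEffects

theorem mainTheorem7 (K m : ℕ) (hK : 3 ≤ K) (hm : 2 ≤ m) (y : Fin K → Fin m → ℝ)
    (h : RandomEffects.Prior) (hh : h.Proper) :
    -- admissible constants `γ, φ, d_R` exist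
    (∃ c : RandomEffects.Tuning, c.Admissible y h) ∧
    ∀ c : RandomEffects.Tuning, c.Admissible y h →
      -- `ξ₀^opt` is the unique minimiser of the drift function
      (∀ ξ : RandomEffects.Loc K, ξ ≠ RandomEffects.xiOpt y c.φ →
        RandomEffects.drift y c.φ (RandomEffects.xiOpt y c.φ) < RandomEffects.drift y c.φ ξ) ∧
      (0 < RandomEffects.epsB y h c ∧ RandomEffects.epsB y h c < 1) ∧
      -- for a suitable `r` the bound falls below every tolerance
      (∃ r : ℝ, 0 < r ∧ r < 1 ∧
        Filter.Tendsto (RandomEffects.burnInBound y h c r) Filter.atTop (nhds 0)) ∧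
      -- everything above is free of `s₀`, and so is the right-hand side below
      ∀ s₀ : ℝ, 0 < s₀ →
        MeasureTheory.IsProbabilityMeasure (RandomEffects.posterior y h s₀) ∧
        ProbabilityTheory.IsMarkovKernel (RandomEffects.blockGibbs y h s₀) ∧
        ∀ (l₀ : RandomEffects.Prec) (r : ℝ), 0 < r → r < 1 → ∀ n : ℕ, 1 ≤ n →
          RandomEffects.tvDist
              ((RandomEffects.blockGibbs y h s₀ ^ n) (l₀, RandomEffects.xiOpt y c.φ))
              (RandomEffects.posterior y h s₀) ≤ RandomEffects.burnInBound y h c r n ∧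
          -- `n` is a sufficient burn-in for the tolerance `burnInBound y h c r n`
          ∀ N : ℕ, n ≤ N →
            RandomEffects.tvDist
              ((RandomEffects.blockGibbs y h s₀ ^ N) (l₀, RandomEffects.xiOpt y c.φ))
              (RandomEffects.posterior y h s₀) ≤ RandomEffects.burnInBound y h c r n := by
  open RandomEffects in
  refine ⟨exists_admissible hK hm y hh, fun c hc => ?_⟩
  obtain ⟨hγδ, hγ1, hφ, hγ, hdR⟩ := hc
  have hK0 : K ≠ 0 := by omega
  have hm0 : m ≠ 0 := by omega
  have hγ0 : 0 < c.γ := (delta_pos_and_lt_one hK hm hh).1.trans hγδ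
  have hg : 0 < 1 - c.γ := by linarith
  have hb := driftConst_nonneg hK hm y hh hφ
  have hd0 : 0 < c.dR := lt_of_le_of_lt (by positivity) hdR
  obtain ⟨hε0, hε1⟩ := epsB_mem_Ioo hK hm y hh hφ hd0
  have hα : 1 < alpha y h c := by
    have hd' : 2 * driftConst y h c.φ < c.dR * (1 - c.γ) := (div_lt_iff₀ hg).1 hdR
    rw [alpha, lt_div_iff₀ (by positivity)]
    linarith
  have hU : 0 < bigU y h c := by unfold bigU; positivity
  refine ⟨fun ξ hξ => drift_xiOpt_lt hK0 hm0 y hφ hξ, ⟨hε0, hε1⟩,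
    exists_tendsto_burnInBound y h c hε0 hε1 hα hU, fun s₀ hs => ?_⟩
  have hP := isMarkovKernel_blockGibbs hK hm y hh hs
  have hπ := isProbabilityMeasure_posterior hK hm y hh hs
  refine ⟨hπ, hP, fun l₀ r hr0 _ n _ => ?_⟩
  have key : ∀ N : ℕ, n ≤ N → tvDist ((blockGibbs y h s₀ ^ N) (l₀, xiOpt y c.φ))
      (posterior y h s₀) ≤ burnInBound y h c r n := fun N hN => by
    have hmass := minorant_real_univ hK hm y hh hs hφ hd0
    have := DriftMinorization.tvDist_pow_le (drift_blockGibbs hK hm y hh hs hφ hγ0.le hγ) hγ0.le hγ1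
      hb hdR (fun x hx => minorant_le hK hm y hh hs hφ hd0 hx) (by rw [hmass]; exact hε1)
      (α := alpha y h c) (U := bigU y h c) rfl rfl
      (invariant_posterior hK hm y hh hs) hr0 hN (l₀, xiOpt y c.φ)
    rw [hmass] at this
    dsimp only at this
    rwa [drift_xiOpt hK0 hm0 y hφ] at this
  exact ⟨key n le_rfl, key⟩
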